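/- **Setting.** For a finite directed graph $G=G(\mathcal V,\mathcal E)$ with source and target maps $s,t$, let $\mathcal E^-=\{e^-\}$ and $\mathcal E^+=\{e^+\}$ be copies of $\mathcal E$, with $s(e^-)=s(e)$, $t(e^-)=t(e)$, $s(e^+)=t(e)$, $t(e^+)=s(e)$. The graph inverse semigroup of $G$ is the semigroup with zero generated by $\mathcal E^-\cup\{\mathbf 1_V:V\in\mathcal V\}\cup\mathcal E^+$ with relations $\mathbf 1_V^2=\mathbf 1_V$; $\mathbf 1_U\mathbf 1_W=0$ for $U\neq W$; $f^-f^+=\mathbf 1_{s(f)}$; $f^-g^+=0$ for $f\ne g$; $e^-=\mathbf 1_{s(e)}e^-=e^-\mathbf 1_{t(e)}$; $e^+=\mathbf 1_{t(e)}e^+=e^+\mathbf 1_{s(e)}$. A word in $\mathcal E^-\cup\mathcal E^+$ is admissible if its product in this semigroup is non-zero, and the Markov-Dyck shift $MD(G)$ is the set of bi-infinite sequences in $\mathcal E^-\cup\mathcal E^+$ all of whose finite subwords are admissible. The zeta function of a shift space $X$ with shift map $S$ is the formal power series $\zeta_X(z)=\exp\left(\sum_{n\ge1}\#\{x\in X:S^nx=x\}\,z^n/n\right)$.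 For $K\geq 1$ and positive integers $N_1,\dots,N_K$ let $\widehat G(N_1,\dots,N_K)$ be the graph whose vertices of height $h$ ($0\le h<K$) are the tuples $(n_1,\dots,n_h)$ with $1\le n_i\le N_i$ (the empty tuple is the root), and whose edges are the tuples $(n_1,\dots,n_{h+1})$ with $0\le h<K$, $1\le n_i\le N_i$; this edge goes from $(n_1,\dots,n_h)$ to $(n_1,\dots,n_{h+1})$ if $h+1<K$, and to the root if $h+1=K$. Put $\psi(e^-)=1$, $\psi(e^+)=-1$. For a vertex $V$ let $\mathcal C(V)$ be the set of non-empty admissible words $b=b_1\cdots b_n$ from $V$ to $V$ with $\sum_{i\le n}\psi(b_i)=0$ and $\sum_{i\le J}\psi(b_i)>0$ for $1\le J<n$, and let $g_V(z)=\sum_{n}\#\{b\in\mathcal C(V):|b|=n\}\,z^n$. **Proposition 4.3.** Let $H\ge0$, $L\ge1$, let $N_1,\dots,N_{H+1}$ be positive integers with $N_{H+1}\ge2$, extend them periodically by $N_{k+H+1}=N_k$, and let $\mathbf N=(N_k)_{1\le k\le L(H+1)}$ be the $L$-fold repetition of the data. Put $\Pi=\prod_{1\le h\le H+1}N_h$.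 Then there are power series $g_0,\dots,g_H$ such that, with $g_{k+H+1}=g_k$, one has $g_V=g_k$ for every vertex $V$ of $\widehat G(\mathbf N)$ of height $k$ ($0\le k<L(H+1)$), and $$\zeta_{MD(\widehat G(\mathbf N))}(z)=\Big(\Big(\prod_{0\le h\le H}(1-g_h(z))\Big)^{L}-\Pi^L z^{L(H+1)}\Big)^{-2}\prod_{0\le k<L(H+1)}(1-g_k(z))^{\,2-\prod_{1\le i\le k}N_i}.$$ In particular, for constant data $N_1=\dots=N_{H+1}=N\ge2$, $H\ge0$, one has, with $\sqrt{1-4Nz^2}$ the power series with constant term $1$ and square $1-4Nz^2$, $$\zeta_{MD(\widehat G((N)_{1\le h\le H+1}))}(z)=2^{\frac{N^{H+1}-1}{N-1}}\left(1+\sqrt{1-4Nz^2}\right)^{2H+2-\frac{N^{H+1}-1}{N-1}}\left(\left(1+\sqrt{1-4Nz^2}\right)^{H+1}-(2Nz)^{H+1}\right)^{-2}.$$ -/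

import Mathlib

/-! Markov-Dyck shifts of directed graphs, their zeta functions, and the rotationally homogeneous
directed graphs given by a sequence of branching numbers. -/

/-- A directed graph (multiple edges and loops allowed) with vertex set `V` and edge set `E`. -/
structure DirGraph (V E : Type) where
  src : E → V
  tgt : E → V

/-- The symbols `e⁻` (`neg e`) and `e⁺` (`pos e`), for `e` an edge. -/
inductive DyckSymbol (E : Type) where
  | neg (e : E)
  | pos (e : E)

namespace DyckSymbol

/-- `ψ(e⁻) = 1`, `ψ(e⁺) = -1`. -/
def psi {E : Type} : DyckSymbol E → ℤ
  | neg _ => 1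
  | pos _ => -1

/-- `s(e⁻) = s(e)`, `s(e⁺) = t(e)`. -/
def src {V E : Type} (G : DirGraph V E) : DyckSymbol E → V
  | neg e => G.src e
  | pos e => G.tgt e

/-- `t(e⁻) = t(e)`, `t(e⁺) = s(e)`. -/
def tgt {V E : Type} (G : DirGraph V E) : DyckSymbol E → V
  | neg e => G.tgt e
  | pos e => G.src e

end DyckSymbol

/-- Generators of the graph inverse semigroup: the symbols `e⁻`, `e⁺`, the idempotents `1_V`,
and the zero element. -/
inductive GISGen (V E : Type) where
  | sym (a : DyckSymbol E)
  | idem (v : V)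
  | zero

namespace DirGraph

variable {V E : Type}

open FreeMonoid in
/-- The defining relations of the graph inverse semigroup of `G`. -/
inductive GISRel (G : DirGraph V E) : FreeMonoid (GISGen V E) → FreeMonoid (GISGen V E) → Prop
  | zero_mul (a : GISGen V E) : GISRel G (of .zero * of a) (of .zero)
  | mul_zero (a : GISGen V E) : GISRel G (of a * of .zero) (of .zero)
  | idem_mul_self (v : V) : GISRel G (of (.idem v) * of (.idem v)) (of (.idem v))
  | idem_mul_of_ne (u w : V) (h : u ≠ w) : GISRel G (of (.idem u) * of (.idem w)) (of .zero)
  | neg_mul_pos (f : E) :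
      GISRel G (of (.sym (.neg f)) * of (.sym (.pos f))) (of (.idem (G.src f)))
  | neg_mul_pos_of_ne (f g : E) (h : f ≠ g) :
      GISRel G (of (.sym (.neg f)) * of (.sym (.pos g))) (of .zero)
  | idem_mul_neg (e : E) :
      GISRel G (of (.idem (G.src e)) * of (.sym (.neg e))) (of (.sym (.neg e)))
  | neg_mul_idem (e : E) :
      GISRel G (of (.sym (.neg e)) * of (.idem (G.tgt e))) (of (.sym (.neg e)))
  | idem_mul_pos (e : E) :
      GISRel G (of (.idem (G.tgt e)) * of (.sym (.pos e))) (of (.sym (.pos e)))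
  | pos_mul_idem (e : E) :
      GISRel G (of (.sym (.pos e)) * of (.idem (G.src e))) (of (.sym (.pos e)))

/-- The graph inverse semigroup of `G`, with an identity element adjoined (the value of the
empty product; no relation involves it). -/
abbrev GIS (G : DirGraph V E) : Type := PresentedMonoid G.GISRel

/-- The product of the symbols of a word in the graph inverse semigroup. -/
def wordProd (G : DirGraph V E) (w : List (DyckSymbol E)) : G.GIS :=
  (w.map fun a => PresentedMonoid.of G.GISRel (.sym a)).prod

/-- A word is admissible if its product in the graph inverse semigroup is not zero. -/
def Admissible (G : DirGraph V E) (w : List (DyckSymbol E)) : Prop :=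
  G.wordProd w ≠ PresentedMonoid.of G.GISRel .zero

/-- The Markov-Dyck shift of `G`: the bi-infinite sequences all of whose finite subwords are
admissible. -/
def markovDyck (G : DirGraph V E) : Set (ℤ → DyckSymbol E) :=
  {x | ∀ (i : ℤ) (n : ℕ), G.Admissible (List.ofFn fun k : Fin n => x (i + (k : ℕ)))}

/-- The code `𝒞(v)`: the admissible words `b` from `v` to `v` with `ψ`-sum zero all of whose
proper nonempty prefixes have positive `ψ`-sum. -/
def code (G : DirGraph V E) (v : V) : Set (List (DyckSymbol E)) :=
  {b | G.Admissible b ∧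
    b.head?.map (DyckSymbol.src G) = some v ∧
    b.getLast?.map (DyckSymbol.tgt G) = some v ∧
    (∀ J : ℕ, 1 ≤ J → J < b.length → 0 < ((b.take J).map DyckSymbol.psi).sum) ∧
    (b.map DyckSymbol.psi).sum = 0}

end DirGraph

/-- The generating function `∑ₙ #{b ∈ 𝒞 : |b| = n} zⁿ` of a set of words over a finite alphabet. -/
noncomputable def codeGenFun {α : Type} (C : Set (List α)) : PowerSeries ℚ :=
  PowerSeries.mk fun n => ({b ∈ C | b.length = n}.ncard : ℚ)

/-- The left shift on `α^ℤ`. -/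
def leftShift {α : Type} (x : ℤ → α) : ℤ → α := fun i => x (i + 1)

/-- The zeta function `exp (∑_{n ≥ 1} #{x ∈ X : Sⁿ x = x} zⁿ / n)` of a shift space `X` over a
finite alphabet, as a formal power series. -/
noncomputable def zetaFun {α : Type} (X : Set (ℤ → α)) : PowerSeries ℚ :=
  (PowerSeries.exp ℚ).subst (PowerSeries.mk fun n =>
    if n = 0 then 0 else ((X ∩ Function.ptsOfPeriod leftShift n).ncard : ℚ) / n)

/-- The vertices of the graph with `K` levels (of heights `0, …, K - 1`) and branching numbers
`N 0, N 1, …`: those of height `h` are the tuples `(n₁, …, n_h)` with `n_i` ranging over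
`N (i - 1)` values. -/
abbrev RHVertex (K : ℕ) (N : ℕ → ℕ) : Type := (h : Fin K) × ((i : Fin h) → Fin (N i))

/-- The edges leaving the vertices of height `h` are the tuples `(n₁, …, n_{h+1})`. -/
abbrev RHEdge (K : ℕ) (N : ℕ → ℕ) : Type := (h : Fin K) × ((i : Fin (h + 1)) → Fin (N i))

/-- The rotationally homogeneous graph with `K` levels: the edge `(n₁, …, n_{h+1})` goes from the
vertex `(n₁, …, n_h)` to the vertex `(n₁, …, n_{h+1})` if `h + 1 < K`, and to the root if
`h + 1 = K`. -/
def rhGraph (K : ℕ) (N : ℕ → ℕ) : DirGraph (RHVertex K N) (RHEdge K N) where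
  src e := ⟨e.1, fun i => e.2 i.castSucc⟩
  tgt e :=
    if h : (e.1 : ℕ) + 1 < K then ⟨⟨(e.1 : ℕ) + 1, h⟩, e.2⟩
    else ⟨⟨0, e.1.pos⟩, fun i => i.elim0⟩

/-- The periodic extension of data `(N_1, …, N_{H+1})`, where `N i` stands for `N_{i+1}`. -/
def periodicData {H : ℕ} (N : Fin (H + 1) → ℕ) : ℕ → ℕ := fun i => N (Fin.ofNat (H + 1) i)

/-! The semigroup acts by partial bijections on pairs (vertex, stack of edges): `e⁻` pushes `e`,
`e⁺` pops it, and zero is nowhere defined. A normal form p⁺q⁻ for products shows conversely that a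
non-empty word with non-zero product has a run. Admissibility thus becomes existence of a run of a
pushdown automaton, with the partial sums of ψ as stack heights.

Points of period n are counted by the sign of their ψ-sum over a period. For sum zero, cutting the
cycle at a minimum of the height leaves a Dyck word at some vertex v, and Dyck words at v are the
free concatenations of words of 𝒞(v). Weighting each cut by the inverse of the number of minima
gives ∑ₘ g_vᵐ/m = -log(1 - g_v). For positive sum, the cycle is cut where an edge that is never
cancelled leaves the root. Heights of vertices rise by one modulo K along every edge, so such cuts
exist and their number is the ψ-sum divided by K; the result is -log(1 - F), with F the generating
function of climbs from root to root with exactly K uncancelled edges. Time reversal matches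
negative sums with positive ones. Hence ζ⁻¹ = (1 - F)² ∏_v (1 - g_v) (`zetaFun_markovDyck_mul`).

Cutting a code word as e⁻de⁺, with d a Dyck word at t(e), gives g_v = ∑ z²/(1 - g_{t(e)}) over the
edges e leaving v. This system has only one solution, z-adically, so g_v depends only on the height
modulo the period of the data (`codeGenFun_congr`). A climb alternates uncancelled edges and Dyck
words, so F is the product over k < K of N z/(1 - g_{k+1}), N being the branching number at height
k. Counting the vertices of each height and clearing denominators gives the formula. For constant
data g(1 - g) = Nz², so 1 - 2g is the square root that occurs. -/

namespace DyckSymbol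

variable {E : Type}

/-- The involution `e⁻ ↔ e⁺`. -/
def flip : DyckSymbol E → DyckSymbol E
  | neg e => pos e
  | pos e => neg e

@[simp] lemma flip_flip (a : DyckSymbol E) : a.flip.flip = a := by cases a <;> rfl

@[simp] lemma psi_flip (a : DyckSymbol E) : a.flip.psi = -a.psi := by cases a <;> rfl

end DyckSymbol

/-! ### The pushdown automaton and its equivalence with admissibility. -/

namespace DirGraph

variable {V E : Type} (G : DirGraph V E)

/-- One step of the pushdown automaton whose states are a vertex and a stack of edges: `e⁻`
pushes `e` and moves from `s(e)` to `t(e)`, and `e⁺` undoes this. -/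
def Step : DyckSymbol E → V × List E → V × List E → Prop
  | .neg e, s, t => s.1 = G.src e ∧ t = (G.tgt e, e :: s.2)
  | .pos e, s, t => t.1 = G.src e ∧ s = (G.tgt e, e :: t.2)

/-- Reading a word with the pushdown automaton. -/
def Run : List (DyckSymbol E) → V × List E → V × List E → Prop
  | [], s, t => s = t
  | a :: w, s, t => ∃ r, G.Step a s r ∧ Run w r t

@[simp] lemma run_nil {s t : V × List E} : G.Run [] s t ↔ s = t := Iff.rfl

lemma run_cons {a : DyckSymbol E} {w s t} :
    G.Run (a :: w) s t ↔ ∃ r, G.Step a s r ∧ G.Run w r t := Iff.rfl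

lemma run_append {w w' : List (DyckSymbol E)} {s t} :
    G.Run (w ++ w') s t ↔ ∃ r, G.Run w s r ∧ G.Run w' r t := by
  induction w generalizing s with
  | nil => simp
  | cons a w ih =>
    simp only [List.cons_append, run_cons, ih]
    constructor
    · rintro ⟨r, h, q, h1, h2⟩; exact ⟨q, ⟨r, h, h1⟩, h2⟩
    · rintro ⟨q, ⟨r, h, h1⟩, h2⟩; exact ⟨r, h, q, h1, h2⟩

@[simp] lemma run_singleton {a : DyckSymbol E} {s t} : G.Run [a] s t ↔ G.Step a s t := by
  simp [run_cons]

lemma step_flip {a : DyckSymbol E} {s t} : G.Step a.flip s t ↔ G.Step a t s := by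
  cases a <;> rfl

/-- Each step is undone by the flipped symbol; this is what makes time reversal preserve the shift.
-/
lemma run_reverse_flip {w : List (DyckSymbol E)} {s t} :
    G.Run (w.reverse.map DyckSymbol.flip) s t ↔ G.Run w t s := by
  induction w generalizing t with
  | nil => simp [eq_comm]
  | cons a w ih =>
    simp only [List.reverse_cons, List.map_append, List.map_cons, List.map_nil, run_append, ih,
      run_singleton, step_flip]
    exact exists_congr fun r => and_comm

variable {G}

lemma Step.src_eq {a : DyckSymbol E} {s t} (h : G.Step a s t) : s.1 = a.src G := by
  cases a with
  | neg e => exact h.1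
  | pos e => rw [h.2]; rfl

lemma Step.tgt_eq {a : DyckSymbol E} {s t} (h : G.Step a s t) : t.1 = a.tgt G := by
  cases a with
  | neg e => rw [h.2]; rfl
  | pos e => exact h.1

lemma Step.append_stack {a : DyckSymbol E} {s t} (h : G.Step a s t) (r : List E) :
    G.Step a (s.1, s.2 ++ r) (t.1, t.2 ++ r) := by
  cases a with
  | neg e => exact ⟨h.1, by rw [h.2]; rfl⟩
  | pos e => exact ⟨h.1, by rw [h.2]; rfl⟩

lemma Run.append_stack {w : List (DyckSymbol E)} {s t} (h : G.Run w s t) (r : List E) :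
    G.Run w (s.1, s.2 ++ r) (t.1, t.2 ++ r) := by
  induction w generalizing s with
  | nil => rw [run_nil] at h; rw [h]; rfl
  | cons a w ih =>
    obtain ⟨q, h1, h2⟩ := h
    exact ⟨_, h1.append_stack r, ih h2⟩

/-- The sum of the values of `ψ` along a word. -/
def psum (w : List (DyckSymbol E)) : ℤ := (w.map DyckSymbol.psi).sum

@[simp] lemma psum_nil : psum ([] : List (DyckSymbol E)) = 0 := rfl

@[simp] lemma psum_cons (a : DyckSymbol E) (w) : psum (a :: w) = a.psi + psum w := by
  simp [psum]

@[simp] lemma psum_append (w w' : List (DyckSymbol E)) : psum (w ++ w') = psum w + psum w' := by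
  simp [psum]

lemma Step.psi_eq {a : DyckSymbol E} {s t} (h : G.Step a s t) :
    (t.2.length : ℤ) = s.2.length + a.psi := by
  cases a with
  | neg e => rw [h.2]; simp [DyckSymbol.psi]
  | pos e => rw [h.2]; simp [DyckSymbol.psi]

lemma Run.psum_eq {w : List (DyckSymbol E)} {s t} (h : G.Run w s t) :
    (t.2.length : ℤ) = s.2.length + psum w := by
  induction w generalizing s with
  | nil => rw [run_nil] at h; simp [h]
  | cons a w ih =>
    obtain ⟨q, h1, h2⟩ := h
    rw [ih h2, h1.psi_eq, psum_cons]; ring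

/-- A run that never reaches below the part `p` of its initial stack does not depend on the
rest of the stack. -/
lemma Run.drop_stack {w : List (DyckSymbol E)} {v : V} {p r : List E} {t}
    (h : G.Run w (v, p ++ r) t) (hw : ∀ J, 0 ≤ p.length + psum (w.take J)) :
    ∃ q, t.2 = q ++ r ∧ G.Run w (v, p) (t.1, q) := by
  induction w generalizing v p with
  | nil => rw [run_nil] at h; exact ⟨p, by rw [← h], by rw [← h]; rfl⟩
  | cons a w ih =>
    obtain ⟨⟨u, s⟩, h1, h2⟩ := h
    cases a with
    | neg e =>
      obtain ⟨h3, h4⟩ := h1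
      simp only [Prod.mk.injEq] at h4
      obtain ⟨rfl, rfl⟩ := h4
      obtain ⟨q, hq, hr⟩ := ih (v := G.tgt e) (p := e :: p) h2 (fun J => by
        have := hw (J + 1)
        simp only [List.take_succ_cons, psum_cons, DyckSymbol.psi] at this
        simp only [List.length_cons]; push_cast; linarith)
      exact ⟨q, hq, _, ⟨h3, rfl⟩, hr⟩
    | pos e =>
      obtain ⟨h3, h4⟩ := h1
      simp only [Prod.mk.injEq] at h3 h4
      obtain ⟨rfl, h4⟩ := h4
      cases p with
      | nil =>
        have := hw 1
        simp [DyckSymbol.psi] at this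
      | cons f p =>
        simp only [List.cons_append, List.cons.injEq] at h4
        obtain ⟨rfl, h4⟩ := h4
        subst h4
        obtain ⟨q, hq, hr⟩ := ih (v := u) (p := p) h2 (fun J => by
          have := hw (J + 1)
          simp only [List.take_succ_cons, psum_cons, DyckSymbol.psi, List.length_cons] at this
          push_cast at this; linarith)
        exact ⟨q, hq, _, ⟨h3, rfl⟩, hr⟩

lemma Run.psum_nonneg {w : List (DyckSymbol E)} {v : V} {t} (h : G.Run w (v, []) t) (J : ℕ) :
    0 ≤ psum (w.take J) := by
  rw [← List.take_append_drop J w, run_append] at h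
  obtain ⟨r, h1, -⟩ := h
  have := h1.psum_eq
  simp only [List.length_nil] at this
  omega

variable (G)

lemma end_mul_apply {X : Type} (f g : Function.End X) (x : X) : (f * g) x = f (g x) := rfl

/-- The partial bijections of the pushdown automaton, acting on sets of states by preimages. -/
def genAction : GISGen V E → Function.End (Set (V × List E))
  | .sym a => fun T => {s | ∃ t ∈ T, G.Step a s t}
  | .idem v => fun T => {s | s ∈ T ∧ s.1 = v}
  | .zero => fun _ => ∅

/-- Taking preimages rather than images makes composition of endomaps agree with the reading order
of words. -/
lemma genAction_rel (a b : FreeMonoid (GISGen V E)) (h : G.GISRel a b) :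
    FreeMonoid.lift G.genAction a = FreeMonoid.lift G.genAction b := by
  cases h with
  | zero_mul a => rw [map_mul]; rfl
  | mul_zero a =>
    rw [map_mul, FreeMonoid.lift_eval_of, FreeMonoid.lift_eval_of]
    funext T
    change G.genAction a ∅ = ∅
    cases a <;> simp [genAction]
  | idem_mul_self v =>
    rw [map_mul, FreeMonoid.lift_eval_of]
    funext T
    rw [end_mul_apply]
    ext s; simp [genAction]
  | idem_mul_of_ne u w h =>
    rw [map_mul, FreeMonoid.lift_eval_of, FreeMonoid.lift_eval_of, FreeMonoid.lift_eval_of]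
    funext T
    rw [end_mul_apply]
    ext s
    simp only [genAction, Set.mem_ofPred_eq, Set.mem_empty_iff_false, iff_false]
    rintro ⟨⟨-, h1⟩, h2⟩
    exact h (h2.symm.trans h1)
  | neg_mul_pos f =>
    rw [map_mul, FreeMonoid.lift_eval_of, FreeMonoid.lift_eval_of, FreeMonoid.lift_eval_of]
    funext T
    rw [end_mul_apply]
    ext s
    simp only [genAction, Set.mem_ofPred_eq, Step]
    constructor
    · rintro ⟨t, ⟨r, hr, h1, rfl⟩, h2, h3⟩
      simp only [Prod.mk.injEq, List.cons.injEq, true_and] at h3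
      have : r = s := Prod.ext (h1.trans h2.symm) h3
      exact ⟨this ▸ hr, h2⟩
    · rintro ⟨h1, h2⟩
      exact ⟨_, ⟨s, h1, h2, rfl⟩, h2, rfl⟩
  | neg_mul_pos_of_ne f g h =>
    rw [map_mul, FreeMonoid.lift_eval_of, FreeMonoid.lift_eval_of, FreeMonoid.lift_eval_of]
    funext T
    rw [end_mul_apply]
    ext s
    simp only [genAction, Set.mem_ofPred_eq, Set.mem_empty_iff_false, iff_false, Step]
    rintro ⟨t, ⟨r, hr, h1, rfl⟩, h2, h3⟩
    simp only [Prod.mk.injEq, List.cons.injEq] at h3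
    exact h h3.2.1.symm
  | idem_mul_neg e =>
    rw [map_mul, FreeMonoid.lift_eval_of, FreeMonoid.lift_eval_of]
    funext T
    rw [end_mul_apply]
    ext s
    simp only [genAction, Set.mem_ofPred_eq, and_iff_left_iff_imp]
    rintro ⟨t, -, h⟩
    exact h.src_eq
  | idem_mul_pos e =>
    rw [map_mul, FreeMonoid.lift_eval_of, FreeMonoid.lift_eval_of]
    funext T
    rw [end_mul_apply]
    ext s
    simp only [genAction, Set.mem_ofPred_eq, and_iff_left_iff_imp]
    rintro ⟨t, -, h⟩
    exact h.src_eq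
  | neg_mul_idem e =>
    rw [map_mul, FreeMonoid.lift_eval_of, FreeMonoid.lift_eval_of]
    funext T
    rw [end_mul_apply]
    ext s
    simp only [genAction, Set.mem_ofPred_eq]
    exact exists_congr fun t => ⟨fun h => ⟨h.1.1, h.2⟩, fun h => ⟨⟨h.1, h.2.tgt_eq⟩, h.2⟩⟩
  | pos_mul_idem e =>
    rw [map_mul, FreeMonoid.lift_eval_of, FreeMonoid.lift_eval_of]
    funext T
    rw [end_mul_apply]
    ext s
    simp only [genAction, Set.mem_ofPred_eq]
    exact exists_congr fun t => ⟨fun h => ⟨h.1.1, h.2⟩, fun h => ⟨⟨h.1, h.2.tgt_eq⟩, h.2⟩⟩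

/-- The action of the graph inverse semigroup on sets of states. -/
def action : G.GIS →* Function.End (Set (V × List E)) :=
  PresentedMonoid.lift G.genAction G.genAction_rel

lemma wordProd_cons (a : DyckSymbol E) (w) :
    G.wordProd (a :: w) = PresentedMonoid.of G.GISRel (.sym a) * G.wordProd w := by
  simp [wordProd]

lemma wordProd_append (w w' : List (DyckSymbol E)) :
    G.wordProd (w ++ w') = G.wordProd w * G.wordProd w' := by
  simp [wordProd]

lemma wordProd_nil : G.wordProd [] = 1 := rfl

lemma wordProd_singleton (a : DyckSymbol E) :
    G.wordProd [a] = PresentedMonoid.of G.GISRel (.sym a) := by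
  simp [wordProd]

lemma action_wordProd (w : List (DyckSymbol E)) (T : Set (V × List E)) :
    G.action (G.wordProd w) T = {s | ∃ t ∈ T, G.Run w s t} := by
  induction w with
  | nil => rw [wordProd_nil, map_one]; ext s; simp [Function.End.one_def]
  | cons a w ih =>
    rw [wordProd_cons, map_mul]
    change G.genAction (.sym a) (G.action (G.wordProd w) T) = _
    rw [ih]
    ext s
    simp only [genAction, Set.mem_ofPred_eq, run_cons]
    constructor
    · rintro ⟨r, ⟨t, ht, h1⟩, h2⟩; exact ⟨t, ht, r, h2, h1⟩
    · rintro ⟨t, ht, r, h2, h1⟩; exact ⟨r, ⟨t, ht, h1⟩, h2⟩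

variable {G}

/-- The start of a run lies in the preimage of the set of all states, whereas zero sends every set
to the empty set. -/
lemma Run.admissible {w : List (DyckSymbol E)} {s t} (h : G.Run w s t) : G.Admissible w := by
  intro h0
  have h1 : s ∈ G.action (G.wordProd w) Set.univ := by
    rw [action_wordProd]; exact ⟨t, trivial, h⟩
  rw [h0] at h1
  exact h1

variable (G)

local notation "ι" => PresentedMonoid.of G.GISRel

lemma of_mul_of {a b c : GISGen V E}
    (h : G.GISRel (FreeMonoid.of a * FreeMonoid.of b) (FreeMonoid.of c)) : ι a * ι b = ι c :=
  PresentedMonoid.mk_eq_mk_of_rel h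

lemma mul_of_zero (x : G.GIS) : x * ι .zero = ι .zero := by
  induction x using PresentedMonoid.inductionOn with
  | _ x =>
    induction x using FreeMonoid.inductionOn with
    | one => rw [map_one, one_mul]
    | of a => exact G.of_mul_of (.mul_zero a)
    | mul x y hx hy => rw [map_mul, mul_assoc, hy, hx]

lemma of_zero_mul (x : G.GIS) : ι .zero * x = ι .zero := by
  induction x using PresentedMonoid.inductionOn with
  | _ x =>
    induction x using FreeMonoid.inductionOn with
    | one => rw [map_one, mul_one]
    | of a => exact G.of_mul_of (.zero_mul a)
    | mul x y hx hy => rw [map_mul, ← mul_assoc, hx, hy]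

lemma idem_src_mul (a : DyckSymbol E) : ι (.idem (a.src G)) * ι (.sym a) = ι (.sym a) := by
  cases a with
  | neg e => exact G.of_mul_of (.idem_mul_neg e)
  | pos e => exact G.of_mul_of (.idem_mul_pos e)

lemma mul_idem_tgt (a : DyckSymbol E) : ι (.sym a) * ι (.idem (a.tgt G)) = ι (.sym a) := by
  cases a with
  | neg e => exact G.of_mul_of (.neg_mul_idem e)
  | pos e => exact G.of_mul_of (.pos_mul_idem e)

lemma idem_mul_of_src_ne {v : V} {a : DyckSymbol E} (h : v ≠ a.src G) :
    ι (.idem v) * ι (.sym a) = ι .zero := by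
  rw [← idem_src_mul, ← mul_assoc, G.of_mul_of (.idem_mul_of_ne _ _ h), of_zero_mul]

/-- The normal form `p⁺ q⁻` of a non-zero product. -/
lemma wordProd_normal_form (u : V) (w : List (DyckSymbol E)) :
    ι (.idem u) * G.wordProd w = ι .zero ∨ ∃ p v q, G.Run w (u, p) (v, q) ∧
      ι (.idem u) * G.wordProd w = ι (.idem u) * G.wordProd (p.map .pos) *
        G.wordProd (q.reverse.map .neg) * ι (.idem v) := by
  induction w using List.reverseRecOn with
  | nil =>
    refine Or.inr ⟨[], u, [], rfl, ?_⟩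
    simp [wordProd_nil, G.of_mul_of (.idem_mul_self u)]
  | append_singleton w a ih =>
    rw [wordProd_append, ← mul_assoc, wordProd_singleton]
    rcases ih with ih | ⟨p, v, q, hr, ih⟩
    · left; rw [ih, of_zero_mul]
    · rw [ih]
      by_cases hv : v = a.src G
      swap
      · left; rw [mul_assoc, G.idem_mul_of_src_ne hv, mul_of_zero]
      subst hv
      rw [mul_assoc, idem_src_mul]
      cases a with
      | neg e =>
        refine Or.inr ⟨p, G.tgt e, e :: q, ?_, ?_⟩
        · rw [run_append]; exact ⟨_, hr, (G.run_singleton).2 ⟨rfl, rfl⟩⟩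
        · rw [List.reverse_cons, List.map_append, wordProd_append, List.map_singleton,
            wordProd_singleton]
          conv_lhs => rw [← mul_idem_tgt]
          simp only [mul_assoc]; rfl
      | pos e =>
        cases q with
        | nil =>
          -- With an empty stack `e⁺` has nothing to cancel: `e` is placed at the bottom of the
          -- initial stack, where the run finds it at the end.
          refine Or.inr ⟨p ++ [e], G.src e, [], ?_, ?_⟩
          · rw [run_append]
            exact ⟨_, hr.append_stack [e], (G.run_singleton).2 ⟨rfl, rfl⟩⟩
          · rw [List.map_append, wordProd_append, List.map_singleton, wordProd_singleton]
            conv_lhs => rw [← mul_idem_tgt]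
            simp only [mul_assoc, List.reverse_nil, List.map_nil, wordProd_nil, one_mul]; rfl
        | cons f q =>
          rw [List.reverse_cons, List.map_append, wordProd_append, List.map_singleton,
            wordProd_singleton]
          by_cases hf : f = e
          · subst hf
            refine Or.inr ⟨p, G.src f, q, ?_, ?_⟩
            · rw [run_append]; exact ⟨_, hr, (G.run_singleton).2 ⟨rfl, rfl⟩⟩
            · simp only [mul_assoc, G.of_mul_of (.neg_mul_pos f)]
          · left
            simp only [mul_assoc, G.of_mul_of (.neg_mul_pos_of_ne _ _ hf), mul_of_zero]

variable {G}

/-- The idempotent at the source of the first letter is absorbed, so the zero alternative of the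
normal form is excluded. -/
lemma Admissible.exists_run {w : List (DyckSymbol E)} (h : G.Admissible w) (h0 : w ≠ []) :
    ∃ s t, G.Run w s t := by
  obtain ⟨a, w, rfl⟩ := List.exists_cons_of_ne_nil h0
  have h1 : ι (.idem (a.src G)) * G.wordProd (a :: w) = G.wordProd (a :: w) := by
    rw [wordProd_cons, ← mul_assoc, idem_src_mul]
  rcases G.wordProd_normal_form (a.src G) (a :: w) with h2 | ⟨p, v, q, h2, -⟩
  · exact absurd (h1.symm.trans h2) h
  · exact ⟨_, _, h2⟩

end DirGraph

/-! ### Generating functions of languages. -/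

section CodeGenFun

variable {α : Type}

lemma coeff_codeGenFun (C : Set (List α)) (n : ℕ) :
    PowerSeries.coeff n (codeGenFun C) = ({b ∈ C | b.length = n}.ncard : ℚ) := by
  simp [codeGenFun]

lemma finite_length_eq [Finite α] (C : Set (List α)) (n : ℕ) : {b ∈ C | b.length = n}.Finite :=
  (List.finite_length_eq α n).subset fun _ h => h.2

lemma codeGenFun_empty : codeGenFun (∅ : Set (List α)) = 0 := by
  ext n; simp [coeff_codeGenFun]

lemma codeGenFun_singleton (w : List α) :
    codeGenFun ({w} : Set (List α)) = PowerSeries.X ^ w.length := by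
  ext n
  rw [coeff_codeGenFun, PowerSeries.coeff_X_pow]
  split_ifs with h
  · subst h
    have : {b ∈ ({w} : Set (List α)) | b.length = w.length} = {w} := by
      ext b; simp only [Set.mem_singleton_iff, Set.mem_ofPred_eq, and_iff_left_iff_imp]
      rintro rfl; rfl
    rw [this]; simp
  · have : {b ∈ ({w} : Set (List α)) | b.length = n} = ∅ := by
      ext b; simp only [Set.mem_singleton_iff, Set.mem_ofPred_eq, Set.mem_empty_iff_false,
        iff_false, not_and]
      rintro rfl h'; exact h h'.symm
    rw [this]; simp

lemma codeGenFun_iUnion [Finite α] {ι : Type} (s : Finset ι) (f : ι → Set (List α))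
    (h : ∀ i ∈ s, ∀ j ∈ s, ∀ w, w ∈ f i → w ∈ f j → i = j) :
    codeGenFun (⋃ i ∈ s, f i) = ∑ i ∈ s, codeGenFun (f i) := by
  classical
  induction s using Finset.induction_on with
  | empty => simp [codeGenFun_empty]
  | insert a s ha ih =>
    rw [Finset.sum_insert ha, ← ih fun i hi j hj =>
      h i (Finset.mem_insert_of_mem hi) j (Finset.mem_insert_of_mem hj)]
    ext n
    rw [map_add, coeff_codeGenFun, coeff_codeGenFun, coeff_codeGenFun, ← Nat.cast_add,
      ← Set.ncard_union_eq _ (finite_length_eq _ _) (finite_length_eq _ _)]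
    · congr 2
      ext w
      simp only [Finset.mem_insert, Set.mem_iUnion, exists_prop, Set.mem_ofPred_eq,
        Set.mem_union]
      constructor
      · rintro ⟨⟨i, rfl | hi, hw⟩, hn⟩
        · exact Or.inl ⟨hw, hn⟩
        · exact Or.inr ⟨⟨i, hi, hw⟩, hn⟩
      · rintro (⟨hw, hn⟩ | ⟨⟨i, hi, hw⟩, hn⟩)
        · exact ⟨⟨a, Or.inl rfl, hw⟩, hn⟩
        · exact ⟨⟨i, Or.inr hi, hw⟩, hn⟩
    · rw [Set.disjoint_left]
      rintro w ⟨hw, -⟩ ⟨hw', -⟩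
      simp only [Set.mem_iUnion, exists_prop] at hw'
      obtain ⟨i, hi, hw'⟩ := hw'
      have := h a (Finset.mem_insert_self _ _) i (Finset.mem_insert_of_mem hi) w hw hw'
      exact ha (this ▸ hi)

/-- The generating function of an unambiguous product of languages. -/
lemma codeGenFun_image2_append [Finite α] {A B : Set (List α)}
    (h : ∀ a ∈ A, ∀ a' ∈ A, ∀ b ∈ B, ∀ b' ∈ B, a ++ b = a' ++ b' → a = a') :
    codeGenFun (Set.image2 (· ++ ·) A B) = codeGenFun A * codeGenFun B := by
  ext n
  rw [PowerSeries.coeff_mul]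
  simp only [coeff_codeGenFun]
  rw [← Finset.sum_coe_sort]
  have hf : ∀ p : Finset.HasAntidiagonal.antidiagonal n,
      Finite ({b ∈ A | b.length = p.1.1} × {b ∈ B | b.length = p.1.2}) := fun p =>
    @Finite.instProd _ _ (finite_length_eq _ _).to_subtype (finite_length_eq _ _).to_subtype
  have e : {b ∈ Set.image2 (· ++ ·) A B | b.length = n}.ncard =
      Nat.card (Σ p : Finset.HasAntidiagonal.antidiagonal n,
        {b ∈ A | b.length = p.1.1} × {b ∈ B | b.length = p.1.2}) := by
    symm
    rw [← Nat.card_coe_set_eq]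
    refine Nat.card_congr (Equiv.ofBijective (fun x => ⟨x.2.1.1 ++ x.2.2.1,
      ⟨x.2.1.1, x.2.1.2.1, x.2.2.1, x.2.2.2.1, rfl⟩, ?_⟩) ⟨?_, ?_⟩)
    · rw [List.length_append, x.2.1.2.2, x.2.2.2.2]
      exact Finset.HasAntidiagonal.mem_antidiagonal.1 x.1.2
    · rintro ⟨⟨⟨i, j⟩, hp⟩, ⟨a, ha, hai⟩, ⟨b, hb, hbj⟩⟩ ⟨⟨⟨i', j'⟩, hp'⟩, ⟨a', ha', hai'⟩, ⟨b', hb', hbj'⟩⟩ he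
      simp only [Subtype.mk.injEq] at he
      dsimp only at hai hbj hai' hbj'
      obtain rfl := h a ha a' ha' b hb b' hb' he
      obtain rfl := List.append_cancel_left he
      subst hai hbj hai' hbj'
      rfl
    · rintro ⟨w, ⟨a, ha, b, hb, rfl⟩, hn⟩
      refine ⟨⟨⟨(a.length, b.length), ?_⟩, ⟨a, ha, rfl⟩, ⟨b, hb, rfl⟩⟩, rfl⟩
      rw [Finset.HasAntidiagonal.mem_antidiagonal, ← hn]; simp
  rw [e, Nat.card_sigma, Nat.cast_sum]
  refine Finset.sum_congr rfl fun p _ => ?_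
  rw [Nat.card_prod, Nat.cast_mul, Nat.card_coe_set_eq, Nat.card_coe_set_eq]

lemma codeGenFun_cons [Finite α] (a : α) (B : Set (List α)) :
    codeGenFun ((a :: ·) '' B) = PowerSeries.X * codeGenFun B := by
  have : (a :: ·) '' B = Set.image2 (· ++ ·) {[a]} B := by
    ext; simp
  rw [this, codeGenFun_image2_append, codeGenFun_singleton]
  · simp
  · rintro _ rfl _ rfl; simp

end CodeGenFun

/-! ### Exponentials and logarithms of formal power series. -/

section ExpSubst

open PowerSeries

lemma expSubst_derivative {a : PowerSeries ℚ} (ha : constantCoeff a = 0) :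
    d⁄dX ℚ ((exp ℚ).subst a) = (exp ℚ).subst a * d⁄dX ℚ a := by
  rw [derivative_subst (HasSubst.of_constantCoeff_zero' ha), derivative_exp]

lemma constantCoeff_expSubst {a : PowerSeries ℚ} (ha : constantCoeff a = 0) :
    constantCoeff ((exp ℚ).subst a) = 1 := by
  rw [← coeff_zero_eq_constantCoeff_apply, coeff_subst' (HasSubst.of_constantCoeff_zero' ha)]
  rw [finsum_eq_single _ 0]
  · simp
  · intro n hn; simp [ha, hn]

/-- A power series with constant term `1` is the exponential of any of its "logarithms". -/
lemma expSubst_mul_eq_one {a R : PowerSeries ℚ} (ha : constantCoeff a = 0)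
    (hR : constantCoeff R = 1) (h : d⁄dX ℚ R = -(R * d⁄dX ℚ a)) : (exp ℚ).subst a * R = 1 := by
  -- Over ℚ a series is determined by its derivative and its constant term; here the derivative of
  -- the product vanishes.
  refine derivative.ext ?_ ?_
  · rw [Derivation.leibniz, expSubst_derivative ha, h]
    rw [show d⁄dX ℚ (1 : PowerSeries ℚ) = 0 from Derivation.map_one_eq_zero _]
    simp only [smul_eq_mul]; ring
  · rw [map_mul, constantCoeff_expSubst ha, hR]; simp

/-- The power series `∑_{m ≥ 1} fᵐ / m`, for `f` without constant term. -/
noncomputable def logInvOneSub (f : PowerSeries ℚ) : PowerSeries ℚ :=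
  mk fun n => ∑ m ∈ Finset.Icc 1 n, coeff n (f ^ m) / m

lemma constantCoeff_logInvOneSub (f : PowerSeries ℚ) : constantCoeff (logInvOneSub f) = 0 := by
  rw [← coeff_zero_eq_constantCoeff_apply, logInvOneSub, coeff_mk]; simp

lemma coeff_pow_eq_zero {f : PowerSeries ℚ} (hf : constantCoeff f = 0) {m n : ℕ} (h : n < m) :
    coeff n (f ^ m) = 0 := by
  have : (X : PowerSeries ℚ) ^ m ∣ f ^ m := pow_dvd_pow_of_dvd (X_dvd_iff.2 hf) m
  exact X_pow_dvd_iff.1 this n h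

/-- Termwise differentiation gives f' times a geometric sum in f. As f has no constant term,
truncating at any N > n does not change the coefficient of degree n, and the remainder left by
telescoping is divisible by Xᴺ. -/
lemma derivative_logInvOneSub {f : PowerSeries ℚ} (hf : constantCoeff f = 0) :
    (1 - f) * d⁄dX ℚ (logInvOneSub f) = d⁄dX ℚ f := by
  have key : ∀ N n : ℕ, n < N →
      coeff n (d⁄dX ℚ (logInvOneSub f)) = coeff n ((∑ m ∈ Finset.range N, f ^ m) * d⁄dX ℚ f) := by
    intro N n hn
    rw [coeff_derivative, logInvOneSub, coeff_mk, Finset.sum_mul (Finset.range N), map_sum]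
    have h1 : ∀ m ∈ Finset.range N, coeff n (f ^ m * d⁄dX ℚ f)
        = coeff (n + 1) (f ^ (m + 1)) / (m + 1 : ℕ) * ((n : ℚ) + 1) := by
      intro m _
      rw [div_mul_eq_mul_div, ← coeff_derivative, derivative_pow, mul_assoc, Nat.add_sub_cancel]
      rw [← map_natCast (C (R := ℚ)) (m + 1), coeff_C_mul]
      field_simp
    rw [Finset.sum_congr rfl h1, ← Finset.sum_mul]
    congr 1
    have h2 : ∑ m ∈ Finset.Icc 1 (n + 1), coeff (n + 1) (f ^ m) / (m : ℚ)
        = ∑ m ∈ Finset.range (n + 1), coeff (n + 1) (f ^ (m + 1)) / ((m + 1 : ℕ) : ℚ) := by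
      rw [Finset.range_eq_Ico, Finset.sum_Ico_add' (fun m : ℕ => coeff (n + 1) (f ^ m) / (m : ℚ))]
      rfl
    rw [h2]
    refine Finset.sum_subset (Finset.range_mono hn) fun m _ hm => ?_
    rw [coeff_pow_eq_zero hf, zero_div]
    simpa using hm
  ext n
  have h1 : coeff n ((1 - f) * d⁄dX ℚ (logInvOneSub f))
      = coeff n ((1 - f) * ((∑ m ∈ Finset.range (n + 1), f ^ m) * d⁄dX ℚ f)) := by
    rw [coeff_mul, coeff_mul]
    refine Finset.sum_congr rfl fun p hp => ?_
    rw [key (n + 1) p.2 (by have := Finset.HasAntidiagonal.mem_antidiagonal.1 hp; omega)]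
  rw [h1, ← mul_assoc, mul_neg_geom_sum, sub_mul, one_mul, map_sub, sub_eq_self]
  have : (X : PowerSeries ℚ) ^ (n + 1) ∣ f ^ (n + 1) * d⁄dX ℚ f :=
    (pow_dvd_pow_of_dvd (X_dvd_iff.2 hf) _).mul_right _
  exact X_pow_dvd_iff.1 this n n.lt_succ_self

lemma expSubst_logInvOneSub_mul {f : PowerSeries ℚ} (hf : constantCoeff f = 0) :
    (exp ℚ).subst (logInvOneSub f) * (1 - f) = 1 := by
  refine expSubst_mul_eq_one (constantCoeff_logInvOneSub f) (by simp [hf]) ?_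
  rw [derivative_logInvOneSub hf]; simp

/-- By `expSubst_mul_eq_one`, exp(-a)exp(-b) is an inverse of exp(a + b), and its factors are
inverses of exp(a) and exp(b). -/
lemma expSubst_add {a b : PowerSeries ℚ} (ha : constantCoeff a = 0) (hb : constantCoeff b = 0) :
    (exp ℚ).subst (a + b) = (exp ℚ).subst a * (exp ℚ).subst b := by
  have neg : ∀ {c : PowerSeries ℚ}, constantCoeff c = 0 →
      constantCoeff (-c) = 0 ∧ d⁄dX ℚ ((exp ℚ).subst (-c)) = -((exp ℚ).subst (-c) * d⁄dX ℚ c) := by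
    intro c hc
    have h : constantCoeff (-c) = 0 := by simp [hc]
    exact ⟨h, by rw [expSubst_derivative h, map_neg]; ring⟩
  have h1 := expSubst_mul_eq_one ha (constantCoeff_expSubst (neg ha).1) (neg ha).2
  have h2 := expSubst_mul_eq_one hb (constantCoeff_expSubst (neg hb).1) (neg hb).2
  have h3 : (exp ℚ).subst (a + b) * ((exp ℚ).subst (-a) * (exp ℚ).subst (-b)) = 1 := by
    refine expSubst_mul_eq_one (by simp [ha, hb]) ?_ ?_
    · rw [map_mul, constantCoeff_expSubst (neg ha).1, constantCoeff_expSubst (neg hb).1, one_mul]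
    · rw [Derivation.leibniz, (neg ha).2, (neg hb).2, map_add]
      simp only [smul_eq_mul]; ring
  linear_combination ((exp ℚ).subst a * (exp ℚ).subst b) * h3
    - (exp ℚ).subst (a + b) * h2 - (exp ℚ).subst (a + b) * (exp ℚ).subst b
      * (exp ℚ).subst (-b) * h1

lemma expSubst_sum {ι : Type} (s : Finset ι) (a : ι → PowerSeries ℚ)
    (ha : ∀ i, constantCoeff (a i) = 0) :
    (exp ℚ).subst (∑ i ∈ s, a i) = ∏ i ∈ s, (exp ℚ).subst (a i) := by
  classical
  induction s using Finset.induction_on with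
  | empty =>
    have := expSubst_mul_eq_one (a := 0) (R := 1) (by simp) (by simp) (by simp)
    simpa using this
  | insert i s hi ih =>
    rw [Finset.sum_insert hi, Finset.prod_insert hi, expSubst_add (ha i), ih]
    rw [map_sum]; exact Finset.sum_eq_zero fun j _ => ha j

end ExpSubst

lemma codeGenFun_union {α : Type} [Finite α] {A B : Set (List α)} (h : Disjoint A B) :
    codeGenFun (A ∪ B) = codeGenFun A + codeGenFun B := by
  ext n
  rw [map_add, coeff_codeGenFun, coeff_codeGenFun, coeff_codeGenFun, ← Nat.cast_add,
    ← Set.ncard_union_eq _ (finite_length_eq _ _) (finite_length_eq _ _)]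
  · congr 2
    ext w
    simp only [Set.mem_ofPred_eq, Set.mem_union]
    tauto
  · exact Set.disjoint_left.2 fun w hw hw' => Set.disjoint_left.1 h hw.1 hw'.1

instance {E : Type} [Finite E] : Finite (DyckSymbol E) :=
  Finite.of_surjective (fun x : E ⊕ E => x.elim DyckSymbol.neg DyckSymbol.pos) fun a => by
    cases a with
    | neg e => exact ⟨.inl e, rfl⟩
    | pos e => exact ⟨.inr e, rfl⟩

/-! ### Dyck words at a vertex and their factorization over the code. -/

namespace DirGraph

open scoped Classical in
/-- The vertex at which the path recorded by the stack starts. -/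
noncomputable def base {V E : Type} (G : DirGraph V E) (s : V × List E) : V :=
  if h : s.2 = [] then s.1 else G.src (s.2.getLast h)

variable {V E : Type} {G : DirGraph V E}

/-- Pushing or popping changes only the far end of the recorded path. So a run from empty stack to
empty stack returns to its vertex, as cutting at zero-sum prefixes requires. -/
lemma Step.base_eq {a : DyckSymbol E} {s t} (h : G.Step a s t) : G.base t = G.base s := by
  have key : ∀ e (s : V × List E), s.1 = G.src e → G.base (G.tgt e, e :: s.2) = G.base s := by
    rintro e ⟨v, p⟩ h
    by_cases hp : p = []
    · subst hp; simpa [base] using h.symm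
    · simp [base, hp, List.getLast_cons]
  cases a with
  | neg e => rw [h.2]; exact key e s h.1
  | pos e => rw [h.2]; exact (key e t h.1).symm

lemma Run.base_eq {w : List (DyckSymbol E)} {s t} (h : G.Run w s t) : G.base t = G.base s := by
  induction w generalizing s with
  | nil => rw [run_nil] at h; rw [h]
  | cons a w ih =>
    obtain ⟨q, h1, h2⟩ := h
    rw [ih h2, h1.base_eq]

lemma Run.eq_of_nil {w : List (DyckSymbol E)} {v u : V} (h : G.Run w (v, []) (u, [])) : u = v := by
  simpa [base] using h.base_eq

lemma psum_take_add (w : List (DyckSymbol E)) (i j : ℕ) :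
    psum (w.take (i + j)) = psum (w.take i) + psum ((w.drop i).take j) := by
  rw [List.take_add, psum_append]

/-- A run that starts with an empty stack can be cut at the prefixes of `ψ`-sum zero. -/
lemma Run.split {w : List (DyckSymbol E)} {v : V} {t} (h : G.Run w (v, []) t) {k : ℕ}
    (hk : psum (w.take k) = 0) :
    G.Run (w.take k) (v, []) (v, []) ∧ G.Run (w.drop k) (v, []) t := by
  rw [← List.take_append_drop k w, run_append] at h
  obtain ⟨⟨u, p⟩, h1, h2⟩ := h
  have h3 := h1.psum_eq
  rw [hk] at h3
  simp only [List.length_nil, Nat.cast_zero, add_zero, Nat.cast_eq_zero,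
    List.length_eq_zero_iff] at h3
  subst h3
  obtain rfl := h1.eq_of_nil
  exact ⟨h1, h2⟩

lemma Run.head_src {w : List (DyckSymbol E)} {s t} (h : G.Run w s t) (hw : w ≠ []) :
    w.head?.map (DyckSymbol.src G) = some s.1 := by
  obtain ⟨a, w, rfl⟩ := List.exists_cons_of_ne_nil hw
  obtain ⟨r, h1, -⟩ := h
  simp [h1.src_eq]

lemma Run.getLast_tgt {w : List (DyckSymbol E)} {s t} (h : G.Run w s t) (hw : w ≠ []) :
    w.getLast?.map (DyckSymbol.tgt G) = some t.1 := by
  obtain ⟨w, a, rfl⟩ := (List.eq_nil_or_concat w).resolve_left hw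
  rw [List.concat_eq_append, run_append] at h
  obtain ⟨r, -, h1⟩ := h
  rw [run_singleton] at h1
  simp [h1.tgt_eq]

lemma Run.of_psum_nonneg {w : List (DyckSymbol E)} {s t} (h : G.Run w s t)
    (hw : ∀ J, 0 ≤ psum (w.take J)) : ∃ q, G.Run w (s.1, []) (t.1, q) := by
  obtain ⟨q, -, hq⟩ := Run.drop_stack (p := []) (r := s.2) h (by simpa using hw)
  exact ⟨q, hq⟩

lemma psum_take_of_length_le {w : List (DyckSymbol E)} {J : ℕ} (h : w.length ≤ J) :
    psum (w.take J) = psum w := by rw [List.take_of_length_le h]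

/-- Non-negative prefix sums allow the run to start with an empty stack, total sum zero empties it
again, and the first and last letters fix the vertices. -/
lemma mem_code_iff {v : V} {b : List (DyckSymbol E)} :
    b ∈ G.code v ↔ b ≠ [] ∧ G.Run b (v, []) (v, []) ∧
      ∀ J, 1 ≤ J → J < b.length → 0 < psum (b.take J) := by
  constructor
  · rintro ⟨h1, h2, h3, h4, h5⟩
    have h0 : b ≠ [] := by rintro rfl; simp at h2
    refine ⟨h0, ?_, h4⟩
    obtain ⟨s, t, hr⟩ := h1.exists_run h0
    have hnn : ∀ J, 0 ≤ psum (b.take J) := by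
      intro J
      rcases J.eq_zero_or_pos with rfl | hJ
      · simp
      · rcases lt_or_ge J b.length with hJ' | hJ'
        · exact (h4 J hJ hJ').le
        · rw [psum_take_of_length_le hJ']; exact h5.ge
    obtain ⟨q, hq⟩ := hr.of_psum_nonneg hnn
    have e1 := hr.head_src h0
    have e2 := hr.getLast_tgt h0
    rw [h2, Option.some_inj] at e1
    rw [h3, Option.some_inj] at e2
    have hl := hq.psum_eq
    rw [show psum b = 0 from h5] at hl
    simp only [List.length_nil, Nat.cast_zero, add_zero, Nat.cast_eq_zero,
      List.length_eq_zero_iff] at hl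
    rwa [← e1, ← e2, hl] at hq
  · rintro ⟨h0, hr, h4⟩
    refine ⟨hr.admissible, hr.head_src h0, hr.getLast_tgt h0, h4, ?_⟩
    simpa [psum] using hr.psum_eq.symm

/-- The words `b` with value `1_v` in the graph inverse semigroup, and the empty word. -/
def dyckWords (G : DirGraph V E) (v : V) : Set (List (DyckSymbol E)) := {w | G.Run w (v, []) (v, [])}

lemma psum_of_mem_dyckWords {v : V} {w : List (DyckSymbol E)} (h : w ∈ G.dyckWords v) :
    psum w = 0 := by
  simpa using (Run.psum_eq h).symm

/-- First-return decomposition: the last letter must pop the edge pushed by the first, and what lies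
between never reaches below that edge. -/
lemma code_eq (v : V) :
    G.code v = ⋃ e ∈ {e | G.src e = v}, (DyckSymbol.neg e :: ·) ''
      Set.image2 (· ++ ·) (G.dyckWords (G.tgt e)) {[DyckSymbol.pos e]} := by
  ext b
  simp only [mem_code_iff, Set.mem_ofPred_eq, Set.mem_iUnion, Set.image2_singleton_right,
    Set.mem_image, exists_exists_and_eq_and, exists_prop]
  constructor
  · rintro ⟨h0, hr, hpos⟩
    obtain ⟨a, w, rfl⟩ := List.exists_cons_of_ne_nil h0
    obtain ⟨s, h1, h2⟩ := hr
    cases a with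
    | pos e => have := h1.2; simp at this
    | neg e =>
      obtain ⟨h3, rfl⟩ := h1
      have hw : w ≠ [] := by rintro rfl; simp at h2
      obtain ⟨d, a, rfl⟩ := (List.eq_nil_or_concat w).resolve_left hw
      rw [List.concat_eq_append] at *
      obtain ⟨⟨u, p⟩, h4, h5⟩ := (G.run_append).1 h2
      rw [run_singleton] at h5
      -- Positive heights inside the code word mean heights at least 0 relative to the stack `[e]`.
      obtain ⟨q, h6, h7⟩ := Run.drop_stack (p := []) (r := [e]) h4 (fun J => by
        have := hpos (min J d.length + 1) (by omega) (by simp)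
        rw [List.take_succ_cons, psum_cons, List.take_append_of_le_length (by omega)] at this
        simp only [DyckSymbol.psi] at this
        have h8 : d.take J = d.take (min J d.length) := by simp [List.take_eq_take_iff]
        rw [h8]
        simp only [List.length_nil, Nat.cast_zero]; omega)
      cases a with
      | neg f => have := h5.2; simp at this
      | pos f =>
        have h8 := h5.2
        simp only [Prod.mk.injEq] at h6 h8
        obtain ⟨rfl, rfl⟩ := h8
        cases q with
        | cons _ _ => simp at h6
        | nil =>
          simp only [List.nil_append, List.cons.injEq, and_true] at h6
          subst h6
          exact ⟨f, h3.symm, d, h7, rfl⟩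
  · rintro ⟨e, he, d, hd, rfl⟩
    subst he
    refine ⟨by simp, ⟨_, ⟨rfl, rfl⟩, ?_⟩, ?_⟩
    · rw [run_append]
      exact ⟨_, Run.append_stack hd [e], (G.run_singleton).2 ⟨rfl, rfl⟩⟩
    · intro J hJ hJ'
      obtain ⟨J, rfl⟩ := Nat.exists_eq_add_of_le' hJ
      simp only [List.length_cons, List.length_append, List.length_nil] at hJ'
      rw [List.take_succ_cons, psum_cons, List.take_append_of_le_length (by omega)]
      have := Run.psum_nonneg hd J
      simp only [DyckSymbol.psi]; omega

/-- The number of proper prefixes of `ψ`-sum zero. -/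
def zeroCount (w : List (DyckSymbol E)) : ℕ :=
  ∑ j ∈ Finset.range w.length, if psum (w.take j) = 0 then 1 else 0

/-- Inside `b` only the empty prefix has sum zero; hence `zeroCount` of a Dyck word is its number of
code factors. -/
lemma zeroCount_append_of_mem_code {v : V} {b r : List (DyckSymbol E)} (hb : b ∈ G.code v) :
    zeroCount (b ++ r) = 1 + zeroCount r := by
  obtain ⟨h0, hr, hpos⟩ := mem_code_iff.1 hb
  rw [zeroCount, List.length_append, Finset.sum_range_add]
  congr 1
  · rw [Finset.sum_eq_single_of_mem 0 (by simpa [List.length_pos_iff] using h0)]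
    · simp
    · intro j hj hj0
      rw [Finset.mem_range] at hj
      rw [List.take_append_of_le_length hj.le]
      have := hpos j (by omega) hj
      rw [if_neg (by omega)]
  · refine Finset.sum_congr rfl fun j _ => ?_
    rw [List.take_length_add_append, psum_append, psum_of_mem_dyckWords hr, zero_add]

lemma dyckWords_zeroCount_zero (v : V) : {w ∈ G.dyckWords v | zeroCount w = 0} = {[]} := by
  ext w
  simp only [Set.mem_ofPred_eq, Set.mem_singleton_iff]
  constructor
  · rintro ⟨-, h⟩
    by_contra hw
    rw [zeroCount, Finset.sum_eq_zero_iff] at h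
    have := h 0 (by simpa [List.length_pos_iff] using hw)
    simp at this
  · rintro rfl; exact ⟨rfl, rfl⟩

lemma exists_code_append {v : V} {w : List (DyckSymbol E)} (hw : w ∈ G.dyckWords v) (h0 : w ≠ []) :
    ∃ b ∈ G.code v, ∃ r ∈ G.dyckWords v, b ++ r = w := by
  -- The first code factor ends at the first return to height zero.
  have hex : ∃ k, 1 ≤ k ∧ psum (w.take k) = 0 :=
    ⟨w.length, List.length_pos_iff.2 h0, by rw [List.take_length]; exact psum_of_mem_dyckWords hw⟩
  obtain ⟨h1, h2⟩ := Nat.find_spec hex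
  have h3 := fun m => Nat.find_min (m := m) hex
  set k := Nat.find hex
  obtain ⟨h4, h5⟩ := Run.split hw h2
  refine ⟨w.take k, mem_code_iff.2 ⟨?_, h4, ?_⟩, w.drop k, h5, List.take_append_drop k w⟩
  · simp [h0]; omega
  · intro J hJ hJ'
    rw [List.length_take] at hJ'
    rw [List.take_take, min_eq_left (by omega)]
    have h6 := Run.psum_nonneg hw J
    have h7 := h3 J (by omega)
    push Not at h7
    have := h7 hJ
    omega

lemma dyckWords_zeroCount_succ (v : V) (m : ℕ) :
    {w ∈ G.dyckWords v | zeroCount w = m + 1} =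
      Set.image2 (· ++ ·) (G.code v) {w ∈ G.dyckWords v | zeroCount w = m} := by
  ext w
  simp only [Set.mem_ofPred_eq, Set.mem_image2]
  constructor
  · rintro ⟨hw, hc⟩
    obtain ⟨b, hb, r, hr, rfl⟩ := exists_code_append hw (by rintro rfl; simp [zeroCount] at hc)
    rw [zeroCount_append_of_mem_code hb] at hc
    exact ⟨b, hb, r, ⟨hr, by omega⟩, rfl⟩
  · rintro ⟨b, hb, r, ⟨hr, hc⟩, rfl⟩
    refine ⟨(G.run_append).2 ⟨_, (mem_code_iff.1 hb).2.1, hr⟩, ?_⟩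
    rw [zeroCount_append_of_mem_code hb, hc, add_comm]

/-- The code is a prefix code: a code word that is a proper prefix of another would be a zero-sum
prefix, where the sum must be positive. Factorizations are therefore unique. -/
lemma code_prefix {v : V} {b b' r r' : List (DyckSymbol E)} (hb : b ∈ G.code v)
    (hb' : b' ∈ G.code v) (h : b ++ r = b' ++ r') : b = b' := by
  have key : ∀ b ∈ G.code v, ∀ s, b ++ s ∈ G.code v → s = [] := by
    intro b hb s hs
    by_contra h
    obtain ⟨h0, hr, -⟩ := mem_code_iff.1 hb
    have h1 := (mem_code_iff.1 hs).2.2 b.length (List.length_pos_iff.2 h0)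
      (by simpa [List.length_pos_iff] using h)
    rw [List.take_left, psum_of_mem_dyckWords hr] at h1
    exact h1.false
  rcases List.append_eq_append_iff.1 h with ⟨s, hs, -⟩ | ⟨s, hs, -⟩
  · rw [hs, key b hb s (hs ▸ hb'), List.append_nil]
  · rw [hs, key b' hb' s (hs ▸ hb), List.append_nil]

lemma codeGenFun_zeroCount [Finite E] (v : V) (m : ℕ) :
    codeGenFun {w ∈ G.dyckWords v | zeroCount w = m} = codeGenFun (G.code v) ^ m := by
  induction m with
  | zero => rw [dyckWords_zeroCount_zero, codeGenFun_singleton]; simp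
  | succ m ih =>
    rw [dyckWords_zeroCount_succ, codeGenFun_image2_append, ih, pow_succ']
    exact fun a ha a' ha' b _ b' _ h => code_prefix ha ha' h

/-- A Dyck word is empty or uniquely a code word followed by a Dyck word, so D = 1 + gD. -/
lemma codeGenFun_dyckWords [Finite E] (v : V) :
    codeGenFun (G.dyckWords v) * (1 - codeGenFun (G.code v)) = 1 := by
  have h : G.dyckWords v = {[]} ∪ Set.image2 (· ++ ·) (G.code v) (G.dyckWords v) := by
    ext w
    constructor
    · intro hw
      by_cases h0 : w = []
      · exact Or.inl h0
      · obtain ⟨b, hb, r, hr, rfl⟩ := exists_code_append hw h0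
        exact Or.inr ⟨b, hb, r, hr, rfl⟩
    · rintro (rfl | ⟨b, hb, r, hr, rfl⟩)
      · exact rfl
      · exact (G.run_append).2 ⟨_, (mem_code_iff.1 hb).2.1, hr⟩
  have h2 : codeGenFun (G.dyckWords v)
      = 1 + codeGenFun (G.code v) * codeGenFun (G.dyckWords v) := by
    conv_lhs => rw [h]
    rw [codeGenFun_union, codeGenFun_singleton, codeGenFun_image2_append]
    · simp
    · exact fun a ha a' ha' b _ b' _ h => code_prefix ha ha' h
    · rw [Set.disjoint_left]
      rintro w hw ⟨b, hb, r, hr, h3⟩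
      rw [Set.mem_singleton_iff] at hw
      subst hw
      exact (mem_code_iff.1 hb).1 (List.append_eq_nil_iff.1 h3).1
  linear_combination h2

lemma codeGenFun_code [Fintype E] [DecidableEq V] (v : V) :
    codeGenFun (G.code v)
      = ∑ e with G.src e = v, PowerSeries.X ^ 2 * codeGenFun (G.dyckWords (G.tgt e)) := by
  have : G.code v = ⋃ e ∈ Finset.univ.filter (fun e => G.src e = v), (DyckSymbol.neg e :: ·) ''
      Set.image2 (· ++ ·) (G.dyckWords (G.tgt e)) {[DyckSymbol.pos e]} := by
    rw [code_eq]; simp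
  rw [this, codeGenFun_iUnion]
  · refine Finset.sum_congr rfl fun e _ => ?_
    rw [codeGenFun_cons, codeGenFun_image2_append, codeGenFun_singleton]
    · simp only [List.length_singleton]; ring
    · rintro a - a' - b rfl b' rfl h
      exact List.append_cancel_right h
  · rintro e - f - w ⟨x, -, rfl⟩ ⟨y, -, h⟩
    simp only [List.cons.injEq, DyckSymbol.neg.injEq] at h
    exact h.1.symm

end DirGraph

/-! ### Climbing words: paths of uncancelled edges interleaved with Dyck words. -/

namespace DirGraph

variable {V E : Type} {G : DirGraph V E}

/-- All non-empty prefixes of the word have positive `ψ`-sum. -/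
def Climbing (w : List (DyckSymbol E)) : Prop := ∀ J, 1 ≤ J → J ≤ w.length → 0 < psum (w.take J)

/-- The words that start with an edge which is never cancelled, and reduce to a path of length `j`
from `v` to `u`. -/
def climbWords (G : DirGraph V E) (u v : V) (j : ℕ) : Set (List (DyckSymbol E)) :=
  {w | (∃ q : List E, q.length = j ∧ G.Run w (v, []) (u, q)) ∧ Climbing w}

lemma Climbing.psum_nonneg {w : List (DyckSymbol E)} (h : Climbing w) (J : ℕ) :
    0 ≤ psum (w.take J) := by
  rcases Nat.eq_zero_or_pos J with rfl | hJ
  · simp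
  · have : w.take J = w.take (min J w.length) := by simp [List.take_eq_take_iff]
    rw [this]
    rcases Nat.eq_zero_or_pos w.length with h0 | h0
    · simp [h0]
    · exact (h _ (by omega) (by omega)).le

lemma climbWords_zero (u v : V) : G.climbWords u v 0 = {w | v = u ∧ w = []} := by
  ext w
  constructor
  · rintro ⟨⟨q, hq, hr⟩, hw⟩
    obtain rfl := List.length_eq_zero_iff.1 hq
    refine ⟨hr.eq_of_nil.symm, ?_⟩
    by_contra h0
    have h1 := hw w.length (List.length_pos_iff.2 h0) le_rfl
    rw [List.take_length] at h1
    have := hr.psum_eq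
    simp at this
    omega
  · rintro ⟨rfl, rfl⟩
    exact ⟨⟨[], rfl, rfl⟩, fun J h1 h2 => by simp at h2; omega⟩

/-- After the first, uncancelled edge, the word is cut at the last return to the height just above
it: a Dyck word precedes the cut, a climb follows it. -/
lemma climbWords_succ (u v : V) (j : ℕ) :
    G.climbWords u v (j + 1) = ⋃ e ∈ {e | G.src e = v}, (DyckSymbol.neg e :: ·) ''
      Set.image2 (· ++ ·) (G.dyckWords (G.tgt e)) (G.climbWords u (G.tgt e) j) := by
  ext w
  simp only [Set.mem_iUnion, exists_prop, Set.mem_ofPred_eq, Set.mem_image, Set.mem_image2]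
  constructor
  · rintro ⟨⟨q, hq, hr⟩, hw⟩
    cases w with
    | nil => rw [run_nil] at hr; simp at hr; simp [hr.2] at hq
    | cons a x =>
    obtain ⟨s, h1, h2⟩ := hr
    cases a with
    | pos e => have := h1.2; simp at this
    | neg e =>
      obtain ⟨h3, rfl⟩ := h1
      have hnn : ∀ J, 0 ≤ psum (x.take J) := by
        intro J
        have h5 : x.take J = x.take (min J x.length) := by simp [List.take_eq_take_iff]
        have := hw (min J x.length + 1) (by omega) (by simp)
        rw [List.take_succ_cons, psum_cons] at this
        simp only [DyckSymbol.psi] at this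
        rw [h5]; omega
      obtain ⟨q', h6, h7⟩ := Run.drop_stack (p := []) (r := [e]) h2 (by simpa using hnn)
      dsimp only at h6 h7
      subst h6
      simp only [List.length_append, List.length_cons, List.length_nil, zero_add,
        Nat.add_right_cancel_iff] at hq
      set P : ℕ → Prop := fun k => psum (x.take k) = 0
      classical
      -- The greatest zero-sum prefix is the last return; the empty prefix ensures that there is
      -- one.
      have hk : P (Nat.findGreatest P x.length) :=
        Nat.findGreatest_spec (P := P) (Nat.zero_le _) (by simp [P])
      have hmax := fun m => Nat.findGreatest_is_greatest (P := P) (n := x.length) (k := m)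
      have hkl := Nat.findGreatest_le (P := P) x.length
      set k := Nat.findGreatest P x.length
      obtain ⟨h8, h9⟩ := Run.split h7 hk
      refine ⟨e, h3.symm, _, ⟨x.take k, h8, x.drop k, ⟨⟨q', hq, h9⟩, ?_⟩, rfl⟩, ?_⟩
      · intro J hJ hJ'
        rw [List.length_drop] at hJ'
        have h10 := psum_take_add x k J
        rw [show psum (x.take k) = 0 from hk, zero_add] at h10
        rw [← h10]
        have h11 := hnn (k + J)
        have h12 : psum (x.take (k + J)) ≠ 0 := hmax (k + J) (by omega) (by omega)
        omega
      · rw [List.take_append_drop]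
  · rintro ⟨e, rfl, _, ⟨d, hd, r, ⟨⟨q, hq, hr⟩, hc⟩, rfl⟩, rfl⟩
    refine ⟨⟨q ++ [e], by simp [hq], _, ⟨rfl, rfl⟩, ?_⟩, ?_⟩
    · exact (G.run_append).2 ⟨_, Run.append_stack hd [e], Run.append_stack hr [e]⟩
    · intro J hJ _
      obtain ⟨J, rfl⟩ := Nat.exists_eq_add_of_le' hJ
      rw [List.take_succ_cons, psum_cons]
      have h1 : 0 ≤ psum ((d ++ r).take J) :=
        Run.psum_nonneg ((G.run_append).2 ⟨_, hd, hr⟩) J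
      simp only [DyckSymbol.psi]; omega

/-- The difference of two such Dyck prefixes would be a non-empty zero-sum prefix of a climb. -/
lemma dyckWords_append_climbWords {v u : V} {j : ℕ} {d d' r r' : List (DyckSymbol E)}
    (hd : d ∈ G.dyckWords v) (hd' : d' ∈ G.dyckWords v) (hr : r ∈ G.climbWords u v j)
    (hr' : r' ∈ G.climbWords u v j) (h : d ++ r = d' ++ r') : d = d' := by
  have key : ∀ d ∈ G.dyckWords v, ∀ s t, d ++ s ∈ G.dyckWords v → s ++ t ∈ G.climbWords u v j →
      s = [] := by
    intro d hd s t hs ht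
    by_contra h
    have h1 := ht.2 s.length (List.length_pos_iff.2 h) (by simp)
    have h2 := psum_of_mem_dyckWords hs
    rw [psum_append, psum_of_mem_dyckWords hd, zero_add] at h2
    rw [List.take_left, h2] at h1
    exact h1.false
  rcases List.append_eq_append_iff.1 h with ⟨s, hs, hs'⟩ | ⟨s, hs, hs'⟩
  · rw [hs, key d hd s r' (hs ▸ hd') (hs' ▸ hr), List.append_nil]
  · rw [hs, key d' hd' s r (hs ▸ hd) (hs' ▸ hr'), List.append_nil]

open scoped Classical in
lemma codeGenFun_climbWords_zero (u v : V) :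
    codeGenFun (G.climbWords u v 0) = if v = u then 1 else 0 := by
  rw [climbWords_zero]
  split_ifs with h
  · have : {w : List (DyckSymbol E) | v = u ∧ w = []} = {[]} := by ext; simp [h]
    rw [this, codeGenFun_singleton]; simp
  · have : {w : List (DyckSymbol E) | v = u ∧ w = []} = ∅ := by ext; simp [h]
    rw [this, codeGenFun_empty]

lemma codeGenFun_climbWords_succ [Fintype E] [DecidableEq V] (u v : V) (j : ℕ) :
    codeGenFun (G.climbWords u v (j + 1)) = ∑ e with G.src e = v,
      PowerSeries.X * codeGenFun (G.dyckWords (G.tgt e)) *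
        codeGenFun (G.climbWords u (G.tgt e) j) := by
  have : G.climbWords u v (j + 1) = ⋃ e ∈ Finset.univ.filter (fun e => G.src e = v),
      (DyckSymbol.neg e :: ·) ''
      Set.image2 (· ++ ·) (G.dyckWords (G.tgt e)) (G.climbWords u (G.tgt e) j) := by
    rw [climbWords_succ]; simp
  rw [this, codeGenFun_iUnion]
  · refine Finset.sum_congr rfl fun e _ => ?_
    rw [codeGenFun_cons, codeGenFun_image2_append, mul_assoc]
    exact fun a ha a' ha' b hb b' hb' h => dyckWords_append_climbWords ha ha' hb hb' h
  · rintro e - f - w ⟨x, -, rfl⟩ ⟨y, -, h⟩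
    simp only [List.cons.injEq, DyckSymbol.neg.injEq] at h
    exact h.1.symm

/-- The word starts at `o` with an edge that is never cancelled. -/
def StartsClimb (G : DirGraph V E) (o : V) (w : List (DyckSymbol E)) : Prop :=
  w.head?.map (DyckSymbol.src G) = some o ∧ Climbing w

open scoped Classical in
/-- The number of edges leaving `o` that are never cancelled. -/
noncomputable def climbCount (G : DirGraph V E) (o : V) (w : List (DyckSymbol E)) : ℕ :=
  ∑ j ∈ Finset.range w.length, if G.StartsClimb o (w.drop j) then 1 else 0

open scoped Classical in
lemma climbCount_cons (o : V) (a : DyckSymbol E) (w) :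
    G.climbCount o (a :: w) = climbCount G o w + if G.StartsClimb o (a :: w) then 1 else 0 := by
  rw [climbCount, List.length_cons, Finset.sum_range_succ']
  rfl

/-- Every suffix of a Dyck word has sum at most zero, so no climb starts inside it. -/
lemma climbCount_append {o v : V} {d r : List (DyckSymbol E)} (hd : d ∈ G.dyckWords v) :
    G.climbCount o (d ++ r) = G.climbCount o r := by
  rw [climbCount, List.length_append, Finset.sum_range_add, Finset.sum_eq_zero, zero_add, climbCount]
  · refine Finset.sum_congr rfl fun j _ => ?_
    rw [List.drop_append, List.drop_eq_nil_of_le (by omega), List.nil_append,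
      Nat.add_sub_cancel_left]
  · intro i hi
    rw [Finset.mem_range] at hi
    rw [if_neg]
    rintro ⟨-, h⟩
    have h1 := h (d.length - i) (by omega) (by simp; omega)
    rw [List.drop_append_of_le_length hi.le, List.take_append_of_le_length (by simp),
      List.take_of_length_le (by simp)] at h1
    have h2 := Run.psum_nonneg hd i
    have h3 : psum (d.take i) + psum (d.drop i) = psum d := by
      rw [← psum_append, List.take_append_drop]
    rw [psum_of_mem_dyckWords hd] at h3
    omega

open scoped Classical in
/-- If all edges raise the height by one modulo `K` and `o` is the only vertex of height `0`,
then every `K`-th edge of a path leaves `o`. -/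
lemma mul_climbCount {K : ℕ} {ht : V → ℕ} {o : V} (h0 : ∀ v, ht v = 0 ↔ v = o)
    (hK : ∀ v, ht v < K) (hstep : ∀ e, ht (G.tgt e) = (ht (G.src e) + 1) % K)
    {u : V} {j : ℕ} {v : V} {w : List (DyckSymbol E)} (hw : w ∈ G.climbWords u v j) :
    K * (G.climbCount o w + if v = o then 0 else 1) + ht u
      = ht v + j + K * if u = o then 0 else 1 := by
  -- With heights unrolled, the edges leaving `o` sit at the multiples of K in [ht v, ht v + j); the
  -- indicator terms come from rounding both ends up to multiples of K.
  induction j generalizing v w with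
  | zero =>
    rw [climbWords_zero] at hw
    obtain ⟨rfl, rfl⟩ := hw
    simp [climbCount]; ring
  | succ j ih =>
    have hw' := hw
    rw [climbWords_succ] at hw
    simp only [Set.mem_iUnion, exists_prop, Set.mem_ofPred_eq, Set.mem_image, Set.mem_image2] at hw
    obtain ⟨e, rfl, _, ⟨d, hd, r, hr, rfl⟩, rfl⟩ := hw
    have h1 : G.StartsClimb o (DyckSymbol.neg e :: (d ++ r)) ↔ G.src e = o := by
      simp [StartsClimb, DyckSymbol.src, hw'.2]
    rw [climbCount_cons, climbCount_append hd]
    simp only [h1]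
    have h2 := ih hr
    have h3 := hstep e
    have h4 := hK (G.src e)
    have h5 : (if G.src e = o then 1 else 0) + (if G.src e = o then 0 else 1) = 1 := by
      split_ifs <;> rfl
    rw [add_assoc, h5]
    rcases Nat.lt_or_ge (ht (G.src e) + 1) K with h6 | h6
    · rw [Nat.mod_eq_of_lt h6] at h3
      rw [if_neg (fun h => by rw [← h0] at h; omega)] at h2
      rw [h2, h3]; ring
    · have h7 : ht (G.src e) + 1 = K := by omega
      rw [h7, Nat.mod_self] at h3
      rw [if_pos ((h0 _).1 h3), h3] at h2
      rw [add_zero] at h2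
      rw [mul_add]
      omega

end DirGraph

/-! ### Periodic sequences as cyclic words, and counting by visits. -/

section Blocks

variable {α : Type}

lemma leftShift_iterate (x : ℤ → α) (i : ℕ) (k : ℤ) : leftShift^[i] x k = x (k + i) := by
  induction i generalizing x with
  | zero => simp
  | succ i ih => rw [Function.iterate_succ_apply, ih, leftShift]; congr 1; push_cast; ring

/-- The word `x₀ ⋯ xₙ₋₁`. -/
def block (x : ℤ → α) (n : ℕ) : List α := List.ofFn fun k : Fin n => x (k : ℕ)

@[simp] lemma length_block (x : ℤ → α) (n : ℕ) : (block x n).length = n := by simp [block]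

@[simp] lemma block_zero (x : ℤ → α) : block x 0 = [] := rfl

lemma block_succ (x : ℤ → α) (n : ℕ) : block x (n + 1) = x 0 :: block (leftShift x) n := by
  simp [block, List.ofFn_succ, leftShift]

lemma block_add (x : ℤ → α) (m n : ℕ) :
    block x (m + n) = block x m ++ block (leftShift^[m] x) n := by
  induction m generalizing x with
  | zero => simp
  | succ m ih => rw [Nat.add_right_comm, block_succ, block_succ, ih]; rfl

lemma take_block (x : ℤ → α) {j n : ℕ} (h : j ≤ n) : (block x n).take j = block x j := by
  obtain ⟨k, rfl⟩ := Nat.exists_eq_add_of_le h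
  rw [block_add, List.take_left' (length_block x j)]

lemma drop_block (x : ℤ → α) {j n : ℕ} (h : j ≤ n) :
    (block x n).drop j = block (leftShift^[j] x) (n - j) := by
  obtain ⟨k, rfl⟩ := Nat.exists_eq_add_of_le h
  rw [block_add, List.drop_left' (length_block x j), Nat.add_sub_cancel_left]

lemma Function.IsPeriodicPt.periodic_int {x : ℤ → α} {n : ℕ}
    (h : Function.IsPeriodicPt leftShift n x) : Function.Periodic x (n : ℤ) := fun i => by
  exact (leftShift_iterate x n i).symm.trans (congrFun h.eq i)

lemma isPeriodicPt_leftShift {x : ℤ → α} {n : ℕ} (h : Function.Periodic x (n : ℤ)) :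
    Function.IsPeriodicPt leftShift n x := by
  funext i; rw [leftShift_iterate]; exact h i

/-- The bi-infinite repetition of a word. -/
def repetition (w : List α) (hw : w ≠ []) : ℤ → α := fun i =>
  w[(i % w.length).toNat]'(by
    have : 0 < w.length := List.length_pos_iff.2 hw
    have := Int.emod_nonneg i (b := w.length) (by omega)
    have := Int.emod_lt_of_pos i (b := w.length) (by omega)
    omega)

lemma isPeriodicPt_repetition (w : List α) (hw : w ≠ []) :
    Function.IsPeriodicPt leftShift w.length (repetition w hw) :=
  isPeriodicPt_leftShift fun i => by simp [repetition]

lemma block_repetition (w : List α) (hw : w ≠ []) : block (repetition w hw) w.length = w := by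
  refine List.ext_getElem (by simp) fun i h1 h2 => ?_
  have : (i : ℤ) % w.length = i := Int.emod_eq_of_lt (by omega) (by omega)
  simp [block, repetition, this]

lemma periodic_eq_of_block {x y : ℤ → α} {n : ℕ} (hn : 0 < n)
    (hx : Function.IsPeriodicPt leftShift n x) (hy : Function.IsPeriodicPt leftShift n y)
    (h : block x n = block y n) : x = y := by
  funext i
  have key : ∀ {z : ℤ → α}, Function.IsPeriodicPt leftShift n z → z i = z (i % n) := by
    intro z hz
    conv_lhs => rw [← Int.emod_add_mul_ediv i n, mul_comm]
    exact hz.periodic_int.int_mul _ _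
  rw [key hx, key hy]
  have h1 := Int.emod_nonneg i (b := n) (by omega)
  have h2 := Int.emod_lt_of_pos i (b := n) (by omega)
  have h3 := congrFun (List.ofFn_injective h) ⟨(i % n).toNat, by omega⟩
  simpa [Int.toNat_of_nonneg h1] using h3

/-- Periodic points correspond to words. -/
lemma ncard_periodic {X : Set (ℤ → α)} {W : Set (List α)} {n : ℕ} (hn : 0 < n)
    (h : ∀ x, Function.IsPeriodicPt leftShift n x → (x ∈ X ↔ block x n ∈ W)) :
    (X ∩ Function.ptsOfPeriod leftShift n).ncard = {w ∈ W | w.length = n}.ncard := by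
  refine Set.ncard_congr (fun x _ => block x n) ?_ ?_ ?_
  · rintro x ⟨hx, hp⟩
    exact ⟨(h x hp).1 hx, length_block x n⟩
  · rintro x y ⟨-, hx⟩ ⟨-, hy⟩ he
    exact periodic_eq_of_block hn hx hy he
  · rintro w ⟨hw, rfl⟩
    have h0 : w ≠ [] := List.length_pos_iff.1 hn
    have hp := isPeriodicPt_repetition w h0
    exact ⟨repetition w h0, ⟨(h _ hp).2 ((block_repetition w h0).symm ▸ hw), hp⟩,
      block_repetition w h0⟩

lemma finite_ptsOfPeriod [Finite α] {n : ℕ} (hn : 0 < n) :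
    (Function.ptsOfPeriod (leftShift (α := α)) n).Finite := by
  refine Set.Finite.of_finite_image (f := fun x => block x n)
    ((List.finite_length_eq α n).subset ?_) ?_
  · rintro _ ⟨x, -, rfl⟩; simp
  · intro x hx y hy he
    exact periodic_eq_of_block hn hx hy he

/-- Counting the elements of a set that is invariant under a periodic map through the visits of
the orbits to a subset. -/
lemma card_div_eq_sum_inv {X : Type} (P : Finset X) (f : X → X) {n : ℕ} (hn : 0 < n)
    (hf : ∀ x ∈ P, f x ∈ P) (hper : ∀ x ∈ P, f^[n] x = x) (c : X → Prop) [DecidablePred c]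
    (hc : ∀ x ∈ P, ∃ j < n, c (f^[j] x)) :
    (P.card : ℚ) / n = ∑ x ∈ P with c x,
      (1 : ℚ) / ((∑ j ∈ Finset.range n, if c (f^[j] x) then 1 else 0 : ℕ) : ℚ) := by
  set m : X → ℕ := fun x => ∑ j ∈ Finset.range n, if c (f^[j] x) then 1 else 0 with hm
  have hmf : ∀ x ∈ P, m (f x) = m x := by
    intro x hx
    have h1 := Finset.sum_range_succ (fun j => if c (f^[j] x) then 1 else 0) n
    have h2 := Finset.sum_range_succ' (fun j => if c (f^[j] x) then 1 else 0) n
    simp only [hper x hx, Function.iterate_zero, id] at h1 h2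
    simp only [hm]
    exact Nat.add_right_cancel (h2.symm.trans h1)
  have hsum : ∀ (h : X → ℚ) (j : ℕ), ∑ x ∈ P, h (f^[j] x) = ∑ x ∈ P, h x := by
    intro h j
    induction j with
    | zero => simp
    | succ j ih =>
      rw [← ih]
      simp only [Function.iterate_succ_apply]
      have hit : ∀ k, ∀ x ∈ P, f^[k] x ∈ P := by
        intro k
        induction k with
        | zero => simp
        | succ k ih => intro x hx; rw [Function.iterate_succ_apply]; exact ih _ (hf x hx)
      refine Finset.sum_nbij' f f^[n - 1] (fun x hx => hf x hx) (fun x hx => hit _ x hx) ?_ ?_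
        fun x _ => rfl
      · intro x hx
        rw [← Function.iterate_succ_apply, Nat.succ_eq_add_one, Nat.sub_add_cancel hn, hper x hx]
      · intro x hx
        rw [← Function.iterate_succ_apply' f, Nat.succ_eq_add_one, Nat.sub_add_cancel hn, hper x hx]
  have hmit : ∀ x ∈ P, ∀ j, m (f^[j] x) = m x ∧ f^[j] x ∈ P := by
    intro x hx j
    induction j with
    | zero => exact ⟨rfl, hx⟩
    | succ j ih =>
      rw [Function.iterate_succ_apply', hmf _ ih.2]
      exact ⟨ih.1, hf _ ih.2⟩
  have hpos : ∀ x ∈ P, (m x : ℚ) ≠ 0 := by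
    intro x hx
    obtain ⟨j, hj, hcj⟩ := hc x hx
    rw [Nat.cast_ne_zero]
    intro h0
    have := Finset.sum_eq_zero_iff.1 h0 j (Finset.mem_range.2 hj)
    simp [hcj] at this
  rw [div_eq_iff (by positivity), Finset.card_eq_sum_ones, Nat.cast_sum]
  -- Each point's unit weight is spread evenly over the m visits of its orbit within n steps. Since
  -- f permutes P and m is constant along orbits, each time j contributes the same sum.
  calc ∑ x ∈ P, ((1 : ℕ) : ℚ)
      = ∑ x ∈ P, ∑ j ∈ Finset.range n, if c (f^[j] x) then 1 / (m (f^[j] x) : ℚ) else 0 := by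
        refine Finset.sum_congr rfl fun x hx => ?_
        have : ∀ j, (if c (f^[j] x) then 1 / (m (f^[j] x) : ℚ) else 0)
            = ((if c (f^[j] x) then 1 else 0 : ℕ) : ℚ) * (1 / m x) := by
          intro j; rw [(hmit x hx j).1]; split_ifs <;> simp
        simp only [this]
        rw [← Finset.sum_mul, ← Nat.cast_sum, mul_one_div, div_self (hpos x hx), Nat.cast_one]
    _ = ∑ j ∈ Finset.range n, ∑ x ∈ P, if c x then 1 / (m x : ℚ) else 0 := by
        rw [Finset.sum_comm]
        exact Finset.sum_congr rfl fun j _ =>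
          hsum (fun x => if c x then 1 / (m x : ℚ) else 0) j
    _ = _ := by
        rw [Finset.sum_const, Finset.card_range, nsmul_eq_mul, mul_comm, Finset.sum_filter]

/-- A sum of inverses, ordered by their values. -/
lemma sum_inv_eq_sum_card {X : Type} (A : Finset X) (m : X → ℕ) {n : ℕ}
    (h : ∀ x ∈ A, m x ∈ Finset.Icc 1 n) :
    ∑ x ∈ A, (1 : ℚ) / (m x : ℚ) = ∑ k ∈ Finset.Icc 1 n, ((A.filter (m · = k)).card : ℚ) / k := by
  rw [← Finset.sum_fiberwise_of_maps_to h]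
  refine Finset.sum_congr rfl fun k _ => ?_
  rw [Finset.sum_congr rfl (g := fun _ => (1 : ℚ) / k)]
  · rw [Finset.sum_const, nsmul_eq_mul, mul_one_div]
  · intro x hx; rw [(Finset.mem_filter.1 hx).2]

end Blocks

/-! ### Periodic points of the Markov-Dyck shift, cut at minima of the height. -/

namespace DirGraph

variable {V E : Type} {G : DirGraph V E}

lemma psum_block_add (x : ℤ → DyckSymbol E) (m n : ℕ) :
    psum (block x (m + n)) = psum (block x m) + psum (block (leftShift^[m] x) n) := by
  rw [block_add, psum_append]

lemma psum_block_mul_add {x : ℤ → DyckSymbol E} {n : ℕ}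
    (hp : Function.IsPeriodicPt leftShift n x) (a b : ℕ) :
    psum (block x (n * a + b)) = a * psum (block x n) + psum (block x b) := by
  induction a with
  | zero => simp
  | succ a ih =>
    rw [show n * (a + 1) + b = n + (n * a + b) by ring, psum_block_add, hp.eq, ih]
    push_cast; ring

lemma psum_block_shift {x : ℤ → DyckSymbol E} {n : ℕ}
    (hp : Function.IsPeriodicPt leftShift n x) (j : ℕ) : psum (block (leftShift^[j] x) n) = psum (block x n) := by
  have h1 := psum_block_add x j n
  rw [add_comm, psum_block_add x n j, hp.eq] at h1
  linarith

lemma isPeriodicPt_shift {x : ℤ → DyckSymbol E} {n : ℕ}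
    (hp : Function.IsPeriodicPt leftShift n x) (j : ℕ) : Function.IsPeriodicPt leftShift n (leftShift^[j] x) :=
  hp.map (Function.Commute.iterate_self leftShift j).semiconj

lemma leftShift_mem_markovDyck {x : ℤ → DyckSymbol E} (hx : x ∈ G.markovDyck) :
    leftShift x ∈ G.markovDyck := by
  intro i n
  have := hx (i + 1) n
  convert this using 4 with k
  simp only [leftShift]; congr 1; ring

lemma exists_run_block {x : ℤ → DyckSymbol E} (hx : x ∈ G.markovDyck) (m : ℕ) :
    ∃ s t, G.Run (block x m) s t := by
  -- The extra letter keeps the word non-empty when m = 0.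
  have h := hx 0 (m + 1)
  simp only [zero_add] at h
  obtain ⟨s, t, hr⟩ := Admissible.exists_run (w := block x (m + 1)) h (by simp [block_succ])
  rw [block_add, run_append] at hr
  obtain ⟨r, h1, -⟩ := hr
  exact ⟨s, r, h1⟩

lemma mem_markovDyck_of_run {x : ℤ → DyckSymbol E} {n : ℕ} (hn : 0 < n)
    (hp : Function.IsPeriodicPt leftShift n x) (h : ∀ m, ∃ s t, G.Run (block x m) s t) :
    x ∈ G.markovDyck := by
  intro i m
  have h1 := Int.emod_nonneg i (b := n) (by omega)
  obtain ⟨s, t, hr⟩ := h ((i % n).toNat + m)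
  rw [block_add, run_append] at hr
  obtain ⟨r, -, hr⟩ := hr
  have : (List.ofFn fun k : Fin m => x (i + (k : ℕ)))
      = block (leftShift^[(i % n).toNat] x) m := by
    rw [block]
    congr 1
    funext k
    rw [leftShift_iterate, Int.toNat_of_nonneg h1]
    conv_lhs => rw [← Int.emod_add_mul_ediv i n]
    rw [show i % n + n * (i / n) + (k : ℕ) = (k : ℕ) + i % n + i / n * n by ring]
    exact hp.periodic_int.int_mul _ _
  rw [this]
  exact hr.admissible

/-- A word that leads from an empty stack at `v` back to `v` can be repeated. -/
lemma mem_markovDyck_of_run_block {x : ℤ → DyckSymbol E} {n : ℕ} (hn : 0 < n)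
    (hp : Function.IsPeriodicPt leftShift n x) {v : V} {q : List E}
    (h : G.Run (block x n) (v, []) (v, q)) : x ∈ G.markovDyck := by
  refine mem_markovDyck_of_run hn hp fun m => ?_
  have key : ∀ a, ∃ q', G.Run (block x (n * a)) (v, []) (v, q') := by
    intro a
    induction a with
    | zero => exact ⟨[], rfl⟩
    | succ a ih =>
      obtain ⟨q', hq'⟩ := ih
      refine ⟨q' ++ q, ?_⟩
      rw [mul_add_one, add_comm, block_add, run_append, hp.eq]
      exact ⟨_, h, hq'.append_stack q⟩
  obtain ⟨q', hq'⟩ := key m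
  obtain ⟨k, hk⟩ := Nat.exists_eq_add_of_le (Nat.le_mul_of_pos_left m hn)
  rw [hk, block_add, run_append] at hq'
  obtain ⟨r, h1, -⟩ := hq'
  exact ⟨_, r, h1⟩

lemma Run.src_zero {x : ℤ → DyckSymbol E} {n : ℕ} (hn : 0 < n) {s t}
    (h : G.Run (block x n) s t) : s.1 = (x 0).src G := by
  obtain ⟨n, rfl⟩ := Nat.exists_eq_add_of_le' hn
  rw [block_succ] at h
  obtain ⟨r, h1, -⟩ := h
  exact h1.src_eq

/-- The heights to the right of `0` are at least that at `0`. -/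
def MinAtZero (x : ℤ → DyckSymbol E) : Prop := ∀ J, 0 ≤ psum (block x J)

/-- The heights to the right of `0` are greater than that at `0`. -/
def StrictMinAtZero (x : ℤ → DyckSymbol E) : Prop := ∀ J, 1 ≤ J → 0 < psum (block x J)

lemma StrictMinAtZero.minAtZero {x : ℤ → DyckSymbol E} (h : StrictMinAtZero x) : MinAtZero x := by
  intro J
  rcases Nat.eq_zero_or_pos J with rfl | hJ
  · simp
  · exact (h J hJ).le

lemma psum_take_block_nonneg {x : ℤ → DyckSymbol E} (h : MinAtZero x) (m J : ℕ) :
    0 ≤ psum ((block x m).take J) := by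
  rcases le_total J m with hJ | hJ
  · rw [take_block x hJ]; exact h J
  · rw [List.take_of_length_le (by simpa using hJ)]; exact h m

lemma MinAtZero.exists_run {x : ℤ → DyckSymbol E} (h : MinAtZero x) (hx : x ∈ G.markovDyck)
    {n : ℕ} (hn : 0 < n) : ∃ t, G.Run (block x n) ((x 0).src G, []) t := by
  obtain ⟨s, t, hr⟩ := exists_run_block hx n
  obtain ⟨q, hq⟩ := hr.of_psum_nonneg (psum_take_block_nonneg h n)
  exact ⟨_, hq.src_zero hn ▸ hq⟩

/-- A minimum at 0 lets the run start with an empty stack, and sum zero empties it after a period.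
Conversely, all later heights are heights of prefixes of the period. -/
lemma neutral_iff {x : ℤ → DyckSymbol E} {n : ℕ} (hn : 0 < n)
    (hp : Function.IsPeriodicPt leftShift n x) (v : V) :
    (x ∈ G.markovDyck ∧ psum (block x n) = 0 ∧ MinAtZero x ∧ (x 0).src G = v) ↔
      block x n ∈ G.dyckWords v := by
  constructor
  · rintro ⟨hx, hT, hmin, rfl⟩
    obtain ⟨⟨u, q⟩, hr⟩ := hmin.exists_run hx hn
    have h1 := hr.psum_eq
    rw [hT] at h1
    simp only [List.length_nil, Nat.cast_zero, add_zero, Nat.cast_eq_zero,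
      List.length_eq_zero_iff] at h1
    subst h1
    obtain rfl := hr.eq_of_nil
    exact hr
  · intro h
    have hT := psum_of_mem_dyckWords h
    refine ⟨mem_markovDyck_of_run_block hn hp h, hT, fun J => ?_, (Run.src_zero hn h).symm⟩
    rw [← Nat.div_add_mod J n, psum_block_mul_add hp, hT, mul_zero, zero_add,
      ← take_block x (Nat.mod_lt J hn).le]
    exact Run.psum_nonneg h _

lemma climb_iff {x : ℤ → DyckSymbol E} {n : ℕ} (hn : 0 < n)
    (hp : Function.IsPeriodicPt leftShift n x) (v : V) (j : ℕ) :
    (x ∈ G.markovDyck ∧ psum (block x n) = j ∧ StrictMinAtZero x ∧ (x 0).src G = v) ↔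
      block x n ∈ G.climbWords v v j := by
  constructor
  · rintro ⟨hx, hT, hmin, rfl⟩
    -- The run is taken one letter past the period: that letter equals the first one, so the period
    -- ends at the vertex where it began.
    obtain ⟨t, hr⟩ := hmin.minAtZero.exists_run hx n.succ_pos
    rw [Nat.succ_eq_add_one, block_add, run_append] at hr
    obtain ⟨⟨u, q⟩, hr, hr'⟩ := hr
    have h1 := hr.psum_eq
    rw [hT] at h1
    have h2 := hr'.src_zero one_pos
    rw [hp.eq] at h2
    dsimp only at h2
    subst h2
    refine ⟨⟨q, by simpa using h1, hr⟩, fun J hJ hJ' => ?_⟩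
    rw [length_block] at hJ'
    rw [take_block x hJ']
    exact hmin J hJ
  · rintro ⟨⟨q, rfl, hr⟩, hc⟩
    have hT := hr.psum_eq
    simp only [List.length_nil, Nat.cast_zero, zero_add] at hT
    refine ⟨mem_markovDyck_of_run_block hn hp hr, hT.symm, fun J hJ => ?_,
      (hr.src_zero hn).symm⟩
    have hpos : 0 < psum (block x n) := by
      have := hc n hn (by simp)
      rwa [take_block x le_rfl] at this
    rw [← Nat.div_add_mod J n, psum_block_mul_add hp]
    have hmod := (Nat.mod_lt J hn)
    rcases Nat.eq_zero_or_pos (J % n) with h0 | h0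
    · have h3 : 0 < J / n := by
        rcases Nat.eq_zero_or_pos (J / n) with h4 | h4
        · have := Nat.div_add_mod J n
          rw [h4, h0] at this; omega
        · exact h4
      rw [h0, block_zero, psum_nil, add_zero]
      positivity
    · have h3 := hc (J % n) h0 (by rw [length_block]; exact hmod.le)
      rw [take_block x hmod.le] at h3
      positivity

open scoped Classical in
lemma sum_minAtZero {x : ℤ → DyckSymbol E} {n : ℕ} (hT : psum (block x n) = 0) (hmin : MinAtZero x) :
    (∑ j ∈ Finset.range n, if MinAtZero (leftShift^[j] x) then 1 else 0)
      = zeroCount (block x n) := by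
  rw [zeroCount, length_block]
  refine Finset.sum_congr rfl fun j hj => ?_
  rw [Finset.mem_range] at hj
  congr 1
  rw [take_block x hj.le, eq_iff_iff]
  constructor
  · intro h
    have h1 := h (n - j)
    have h2 := psum_block_add x j (n - j)
    rw [Nat.add_sub_cancel' hj.le, hT] at h2
    have := hmin j
    omega
  · intro h J
    have h1 := psum_block_add x j J
    have := hmin (j + J)
    omega

-- Strict minimality at time j concerns the infinite future, but the rest of the period decides it:
-- from the end of the period on, heights are at least the height there, as 0 is a minimum.
open scoped Classical in
lemma sum_strictMinAtZero {x : ℤ → DyckSymbol E} {n : ℕ}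
    (hp : Function.IsPeriodicPt leftShift n x) (hmin : StrictMinAtZero x) (o : V) :
    (∑ j ∈ Finset.range n,
      if StrictMinAtZero (leftShift^[j] x) ∧ (leftShift^[j] x 0).src G = o then 1 else 0)
      = G.climbCount o (block x n) := by
  rw [climbCount, length_block]
  refine Finset.sum_congr rfl fun j hj => ?_
  rw [Finset.mem_range] at hj
  congr 1
  rw [drop_block x hj.le, eq_iff_iff, StartsClimb, and_comm]
  obtain ⟨k, rfl⟩ := Nat.exists_eq_add_of_lt hj
  rw [show j + k + 1 - j = k + 1 by omega]
  refine and_congr (by simp [block_succ]) ⟨fun h J hJ hJ' => ?_, fun h J hJ => ?_⟩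
  · rw [length_block] at hJ'
    rw [take_block _ hJ']
    exact h J hJ
  · rcases le_total J (k + 1) with hJ' | hJ'
    · have := h J hJ (by simpa using hJ')
      rwa [take_block _ hJ'] at this
    · obtain ⟨i, rfl⟩ := Nat.exists_eq_add_of_le hJ'
      have h1 := h (k + 1) (by omega) (by simp)
      rw [take_block _ le_rfl] at h1
      rw [psum_block_add, ← Function.iterate_add_apply, add_comm (k + 1) j, ← add_assoc, hp.eq]
      have := hmin.minAtZero i
      omega

/-- The heights along a neutral periodic point attain their minimum. -/
lemma exists_minAtZero {x : ℤ → DyckSymbol E} {n : ℕ} (hn : 0 < n)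
    (hp : Function.IsPeriodicPt leftShift n x) (hT : psum (block x n) = 0) :
    ∃ j < n, MinAtZero (leftShift^[j] x) := by
  obtain ⟨j, hj, hmin⟩ := Finset.exists_min_image (Finset.range n) (fun j => psum (block x j))
    ⟨0, Finset.mem_range.2 hn⟩
  refine ⟨j, Finset.mem_range.1 hj, fun J => ?_⟩
  have h1 := psum_block_add x j J
  have h2 := hmin ((j + J) % n) (Finset.mem_range.2 (Nat.mod_lt _ hn))
  rw [← Nat.div_add_mod (j + J) n, psum_block_mul_add hp, hT, mul_zero, zero_add] at h1
  omega

lemma exists_strictMinAtZero {x : ℤ → DyckSymbol E} {n : ℕ} (hn : 0 < n)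
    (hp : Function.IsPeriodicPt leftShift n x) (hT : 0 < psum (block x n)) :
    ∃ j < n, StrictMinAtZero (leftShift^[j] x) := by
  -- Minimising n·height - j selects the last of the lowest positions in the period: as 0 ≤ j < n,
  -- the term -j only breaks ties.
  obtain ⟨j, hj, hmin⟩ := Finset.exists_min_image (Finset.range n)
    (fun j => (n : ℤ) * psum (block x j) - j) ⟨0, Finset.mem_range.2 hn⟩
  rw [Finset.mem_range] at hj
  refine ⟨j, hj, fun J hJ => ?_⟩
  have h1 := psum_block_add x j J
  have hb := Nat.mod_lt (j + J) hn
  have h2 := hmin ((j + J) % n) (Finset.mem_range.2 hb)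
  have h3 := Nat.div_add_mod (j + J) n
  rw [← h3, psum_block_mul_add hp] at h1
  set b := (j + J) % n
  set a := (j + J) / n
  set pb := psum (block x b)
  set pj := psum (block x j)
  have h4 : (n : ℤ) * (pb - pj) ≥ b - j := by rw [mul_sub]; linarith
  have h5 : pj ≤ pb := by
    by_contra h
    have : (n : ℤ) * (pb - pj) ≤ n * (-1) := by gcongr; omega
    omega
  rcases Nat.eq_zero_or_pos a with h0 | h0
  · rw [h0] at h3 h1
    have h6 : j < b := by omega
    have h7 : pj < pb := by
      rcases h5.lt_or_eq with h | h
      · exact h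
      · rw [h, sub_self, mul_zero] at h4; omega
    simp only [Nat.cast_zero, zero_mul, zero_add] at h1
    omega
  · have : 0 < (a : ℤ) * psum (block x n) := by positivity
    omega

end DirGraph

/-! ### The three classes of periodic points and the zeta function. -/

namespace DirGraph

variable {V E : Type} {G : DirGraph V E}

lemma zeroCount_mem_Icc {v : V} {w : List (DyckSymbol E)} (hw : w ∈ G.dyckWords v) (h0 : w ≠ []) :
    zeroCount w ∈ Finset.Icc 1 w.length := by
  rw [Finset.mem_Icc]
  constructor
  · by_contra h
    have h1 : w ∈ {w ∈ G.dyckWords v | zeroCount w = 0} := ⟨hw, by omega⟩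
    rw [dyckWords_zeroCount_zero] at h1
    exact h0 h1
  · rw [zeroCount, Finset.sum_boole, Nat.cast_id]
    exact (Finset.card_filter_le _ _).trans_eq (Finset.card_range _)

lemma climbCount_le (o : V) (w : List (DyckSymbol E)) : G.climbCount o w ≤ w.length := by
  classical
  rw [climbCount, Finset.sum_boole, Nat.cast_id]
  exact (Finset.card_filter_le _ _).trans_eq (Finset.card_range _)

open PowerSeries in
/-- The periodic points with neutral multiplier. -/
lemma ncard_neutral_div [Fintype V] [Finite E] {n : ℕ} (hn : 0 < n) :
    (({x ∈ G.markovDyck | psum (block x n) = 0} ∩ Function.ptsOfPeriod leftShift n).ncard : ℚ) / n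
      = ∑ v, coeff n (logInvOneSub (codeGenFun (G.code v))) := by
  classical
  have hfin : ({x ∈ G.markovDyck | psum (block x n) = 0} ∩
    Function.ptsOfPeriod leftShift n).Finite := (finite_ptsOfPeriod hn).inter_of_right _
  rw [Set.ncard_eq_toFinset_card _ hfin]
  have hmem : ∀ x, x ∈ hfin.toFinset ↔ (x ∈ G.markovDyck ∧ psum (block x n) = 0) ∧
      Function.IsPeriodicPt leftShift n x := fun x => hfin.mem_toFinset
  rw [card_div_eq_sum_inv hfin.toFinset leftShift hn (c := MinAtZero)]
  rotate_left
  · intro x hx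
    rw [hmem] at hx ⊢
    exact ⟨⟨leftShift_mem_markovDyck hx.1.1, (psum_block_shift hx.2 1).trans hx.1.2⟩,
      isPeriodicPt_shift hx.2 1⟩
  · intro x hx; exact ((hmem x).1 hx).2
  · intro x hx
    rw [hmem] at hx
    exact exists_minAtZero hn hx.2 hx.1.2
  set A := hfin.toFinset.filter MinAtZero with hA
  have hmemA : ∀ x, x ∈ A ↔ ((x ∈ G.markovDyck ∧ psum (block x n) = 0) ∧
      Function.IsPeriodicPt leftShift n x) ∧ MinAtZero x := fun x => by
    rw [hA, Finset.mem_filter, hmem]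
  have hzc : ∀ x ∈ A, (1 : ℚ) /
      ((∑ j ∈ Finset.range n, if MinAtZero (leftShift^[j] x) then 1 else 0 : ℕ) : ℚ)
      = 1 / (zeroCount (block x n) : ℚ) := by
    intro x hx
    rw [hmemA] at hx
    rw [sum_minAtZero hx.1.1.2 hx.2]
  rw [Finset.sum_congr rfl hzc, ← Finset.sum_fiberwise A (fun x => (x 0).src G)]
  refine Finset.sum_congr rfl fun v _ => ?_
  have hAv : ∀ x, x ∈ A.filter (fun x => (x 0).src G = v) ↔
      block x n ∈ G.dyckWords v ∧ Function.IsPeriodicPt leftShift n x := by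
    intro x
    rw [Finset.mem_filter, hmemA]
    constructor
    · rintro ⟨⟨⟨⟨h1, h2⟩, h3⟩, h4⟩, h5⟩
      exact ⟨(neutral_iff hn h3 v).1 ⟨h1, h2, h4, h5⟩, h3⟩
    · rintro ⟨h1, h3⟩
      obtain ⟨h1, h2, h4, h5⟩ := (neutral_iff hn h3 v).2 h1
      exact ⟨⟨⟨⟨h1, h2⟩, h3⟩, h4⟩, h5⟩
  -- Points with k minima per period correspond to products of k code words, which yields the terms
  -- g_vᵏ/k.
  rw [sum_inv_eq_sum_card (n := n), logInvOneSub, coeff_mk]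
  · refine Finset.sum_congr rfl fun k _ => ?_
    rw [← codeGenFun_zeroCount, coeff_codeGenFun, ← ncard_periodic hn
      (X := {x | block x n ∈ G.dyckWords v ∧ zeroCount (block x n) = k}) (fun _ _ => Iff.rfl),
      ← Set.ncard_coe_finset]
    congr 3
    ext x
    rw [Finset.mem_coe, Finset.mem_filter, hAv]
    exact and_right_comm
  · intro x hx
    rw [hAv] at hx
    have := zeroCount_mem_Icc hx.1 (by rw [← List.length_pos_iff, length_block]; exact hn)
    rwa [length_block] at this

open PowerSeries in
/-- The periodic points with negative multiplier. -/
lemma ncard_climb_div [Finite E] {K : ℕ} {ht : V → ℕ} {o : V} (h0 : ∀ v, ht v = 0 ↔ v = o)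
    (hK : ∀ v, ht v < K) (hstep : ∀ e, ht (G.tgt e) = (ht (G.src e) + 1) % K)
    {F : PowerSeries ℚ} (hF : ∀ m, codeGenFun (G.climbWords o o (K * m)) = F ^ m)
    {n : ℕ} (hn : 0 < n) :
    (({x ∈ G.markovDyck | 0 < psum (block x n)} ∩ Function.ptsOfPeriod leftShift n).ncard : ℚ) / n
      = coeff n (logInvOneSub F) := by
  classical
  have hK0 : 0 < K := (Nat.zero_le _).trans_lt (hK o)
  have hfin : ({x ∈ G.markovDyck | 0 < psum (block x n)} ∩
    Function.ptsOfPeriod leftShift n).Finite := (finite_ptsOfPeriod hn).inter_of_right _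
  rw [Set.ncard_eq_toFinset_card _ hfin]
  have hmem : ∀ x, x ∈ hfin.toFinset ↔ (x ∈ G.markovDyck ∧ 0 < psum (block x n)) ∧
      Function.IsPeriodicPt leftShift n x := fun x => hfin.mem_toFinset
  have hmd : ∀ (j : ℕ) x, x ∈ G.markovDyck → leftShift^[j] x ∈ G.markovDyck := by
    intro j
    induction j with
    | zero => exact fun x hx => hx
    | succ j ih => exact fun x hx => ih _ (leftShift_mem_markovDyck hx)
  have hclimb : ∀ x, x ∈ G.markovDyck → 0 < psum (block x n) →
      Function.IsPeriodicPt leftShift n x → StrictMinAtZero x →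
      block x n ∈ G.climbWords ((x 0).src G) ((x 0).src G) (psum (block x n)).toNat ∧
        (K * G.climbCount o (block x n) : ℤ) = psum (block x n) := by
    intro x h1 h2 h3 h4
    have h5 := (climb_iff hn h3 ((x 0).src G) (psum (block x n)).toNat).1
      ⟨h1, (Int.toNat_of_nonneg h2.le).symm, h4, rfl⟩
    refine ⟨h5, ?_⟩
    -- The climb is closed, so the boundary terms on the two sides cancel and K times the count is
    -- the ψ-sum.
    have h6 := mul_climbCount h0 hK hstep h5
    rw [mul_add] at h6
    have h7 := Int.toNat_of_nonneg h2.le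
    rw [← h7]
    exact_mod_cast (by omega :
      K * G.climbCount o (block x n) = (psum (block x n)).toNat)
  rw [card_div_eq_sum_inv hfin.toFinset leftShift hn
    (c := fun x => StrictMinAtZero x ∧ (x 0).src G = o)]
  rotate_left
  · intro x hx
    rw [hmem] at hx ⊢
    exact ⟨⟨leftShift_mem_markovDyck hx.1.1, hx.1.2.trans_eq (psum_block_shift hx.2 1).symm⟩,
      isPeriodicPt_shift hx.2 1⟩
  · intro x hx; exact ((hmem x).1 hx).2
  · intro x hx
    rw [hmem] at hx
    obtain ⟨j, -, hj⟩ := exists_strictMinAtZero hn hx.2 hx.1.2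
    have hp := isPeriodicPt_shift hx.2 j
    have hT := psum_block_shift hx.2 j
    -- Cutting first at an arbitrary strict minimum, the positive ψ-sum forces a non-zero count,
    -- hence a strict minimum at `o`.
    have h2 := (hclimb _ (hmd j x hx.1.1) (hT.symm ▸ hx.1.2) hp hj).2
    rw [← sum_strictMinAtZero hp hj o] at h2
    have h3 : (∑ i ∈ Finset.range n, if StrictMinAtZero (leftShift^[i] (leftShift^[j] x)) ∧
        (leftShift^[i] (leftShift^[j] x) 0).src G = o then 1 else 0) ≠ 0 := by
      intro h
      rw [h, hT] at h2
      have := hx.1.2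
      simp at h2
      omega
    obtain ⟨i, hi, h4⟩ := Finset.exists_ne_zero_of_sum_ne_zero h3
    rw [ne_eq, ite_eq_right_iff, Classical.not_imp] at h4
    refine ⟨(i + j) % n, Nat.mod_lt _ hn, ?_⟩
    rw [hx.2.iterate_mod_apply, Function.iterate_add_apply]
    exact h4.1
  set A := hfin.toFinset.filter (fun x => StrictMinAtZero x ∧ (x 0).src G = o) with hA
  have hmemA : ∀ x, x ∈ A ↔ ((x ∈ G.markovDyck ∧ 0 < psum (block x n)) ∧
      Function.IsPeriodicPt leftShift n x) ∧ StrictMinAtZero x ∧ (x 0).src G = o := fun x => by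
    rw [hA, Finset.mem_filter, hmem]
  have hcc : ∀ x ∈ A, (1 : ℚ) /
      ((∑ j ∈ Finset.range n, if StrictMinAtZero (leftShift^[j] x) ∧
        (leftShift^[j] x 0).src G = o then 1 else 0 : ℕ) : ℚ)
      = 1 / (G.climbCount o (block x n) : ℚ) := by
    intro x hx
    rw [hmemA] at hx
    rw [sum_strictMinAtZero hx.1.2 hx.2.1]
  rw [Finset.sum_congr rfl hcc, sum_inv_eq_sum_card (n := n), logInvOneSub, coeff_mk]
  · refine Finset.sum_congr rfl fun k hk => ?_
    rw [← hF, coeff_codeGenFun, ← ncard_periodic hn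
      (X := {x | block x n ∈ G.climbWords o o (K * k)}) (W := G.climbWords o o (K * k))
      (fun _ _ => Iff.rfl),
      ← Set.ncard_coe_finset]
    congr 3
    ext x
    rw [Finset.mem_coe, Finset.mem_filter, hmemA]
    constructor
    · rintro ⟨⟨⟨⟨h1, h2⟩, h3⟩, h4, rfl⟩, rfl⟩
      obtain ⟨h5, h6⟩ := hclimb x h1 h2 h3 h4
      rw [← h6] at h5
      exact ⟨by exact_mod_cast h5, h3⟩
    · rintro ⟨h1, h3⟩
      have h2 := mul_climbCount h0 hK hstep h1
      obtain ⟨h4, h5, h6, h7⟩ := (climb_iff hn h3 o (K * k)).2 h1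
      have hk0 := (Finset.mem_Icc.1 hk).1
      refine ⟨⟨⟨⟨h4, ?_⟩, h3⟩, h6, h7⟩, ?_⟩
      · rw [h5]; positivity
      · rw [mul_add] at h2
        exact Nat.eq_of_mul_eq_mul_left hK0 (by omega)
  · intro x hx
    obtain ⟨⟨⟨h1, h2⟩, h3⟩, h4, h5⟩ := (hmemA x).1 hx
    have h6 := (hclimb x h1 h2 h3 h4).2
    rw [Finset.mem_Icc]
    refine ⟨Nat.one_le_iff_ne_zero.2 fun h => ?_, (climbCount_le o _).trans_eq (length_block x n)⟩
    rw [h] at h6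
    simp at h6
    omega

/-- Time reversal. -/
def timeReversal (x : ℤ → DyckSymbol E) : ℤ → DyckSymbol E := fun i => (x (-i - 1)).flip

lemma timeReversal_involutive : Function.Involutive (timeReversal (E := E)) := fun x => by
  funext i
  simp only [timeReversal, DyckSymbol.flip_flip]
  congr 1; ring

lemma ofFn_timeReversal (x : ℤ → DyckSymbol E) (i : ℤ) (n : ℕ) :
    (List.ofFn fun k : Fin n => timeReversal x (i + (k : ℕ)))
      = ((List.ofFn fun k : Fin n => x (-i - n + (k : ℕ))).reverse).map DyckSymbol.flip := by
  refine List.ext_getElem (by simp) fun j h1 h2 => ?_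
  simp only [List.length_ofFn] at h1
  simp only [timeReversal, List.getElem_ofFn, List.getElem_map, List.getElem_reverse,
    List.length_ofFn]
  congr 2
  push_cast [Nat.cast_sub (show 1 ≤ n by omega), Nat.cast_sub (show j ≤ n - 1 by omega)]
  ring

lemma psum_reverse_flip (w : List (DyckSymbol E)) :
    psum (w.reverse.map DyckSymbol.flip) = -psum w := by
  induction w with
  | nil => simp
  | cons a w ih =>
    rw [List.reverse_cons, List.map_append, psum_append, ih, psum_cons]
    simp [add_comm]

lemma timeReversal_mem_markovDyck {x : ℤ → DyckSymbol E} (hx : x ∈ G.markovDyck) :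
    timeReversal x ∈ G.markovDyck := by
  intro i n
  have h := hx (-i - n) n
  rw [ofFn_timeReversal]
  rcases Nat.eq_zero_or_pos n with rfl | hn
  · simpa using h
  · obtain ⟨s, t, hr⟩ := h.exists_run (by rw [← List.length_pos_iff]; simpa using hn)
    exact ((G.run_reverse_flip).2 hr).admissible

lemma isPeriodicPt_timeReversal {x : ℤ → DyckSymbol E} {n : ℕ}
    (hp : Function.IsPeriodicPt leftShift n x) :
    Function.IsPeriodicPt leftShift n (timeReversal x) := by
  refine isPeriodicPt_leftShift fun i => ?_
  simp only [timeReversal]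
  rw [show -(i + (n : ℤ)) - 1 = -i - 1 - n by ring, hp.periodic_int.sub_eq]

lemma psum_block_timeReversal {x : ℤ → DyckSymbol E} {n : ℕ}
    (hp : Function.IsPeriodicPt leftShift n x) :
    psum (block (timeReversal x) n) = -psum (block x n) := by
  have h := ofFn_timeReversal x 0 n
  simp only [zero_add] at h
  rw [block, h, psum_reverse_flip, block]
  congr 3
  funext k
  rw [show -0 - (n : ℤ) + (k : ℕ) = (k : ℕ) - (n : ℤ) by ring, hp.periodic_int.sub_eq]

/-- Time reversal is an involution of the shift that keeps periods and negates the ψ-sum. -/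
lemma ncard_fall_eq_climb (n : ℕ) :
    ({x ∈ G.markovDyck | psum (block x n) < 0} ∩ Function.ptsOfPeriod leftShift n).ncard
      = ({x ∈ G.markovDyck | 0 < psum (block x n)} ∩ Function.ptsOfPeriod leftShift n).ncard := by
  rw [← Set.ncard_image_of_injective _ timeReversal_involutive.injective]
  congr 1
  ext x
  rw [timeReversal_involutive.image_eq_preimage_symm]
  constructor
  · rintro ⟨⟨h1, h2⟩, h3⟩
    have h4 := isPeriodicPt_timeReversal h3
    have h5 := timeReversal_mem_markovDyck h1
    have h6 := psum_block_timeReversal h3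
    rw [timeReversal_involutive x] at h4 h5 h6
    exact ⟨⟨h5, by omega⟩, h4⟩
  · rintro ⟨⟨h1, h2⟩, h3⟩
    exact ⟨⟨timeReversal_mem_markovDyck h1, by rw [psum_block_timeReversal h3]; omega⟩,
      isPeriodicPt_timeReversal h3⟩

lemma constantCoeff_codeGenFun_code [Finite E] (v : V) :
    PowerSeries.constantCoeff (codeGenFun (G.code v)) = 0 := by
  rw [← PowerSeries.coeff_zero_eq_constantCoeff_apply, coeff_codeGenFun]
  have : {b ∈ G.code v | b.length = 0} = ∅ := by
    ext b
    simp only [Set.mem_ofPred_eq, Set.mem_empty_iff_false, iff_false, not_and]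
    exact fun hb h => (mem_code_iff.1 hb).1 (List.length_eq_zero_iff.1 h)
  rw [this]; simp

open PowerSeries in
/-- The zeta function of the Markov-Dyck shift of a graph all of whose closed paths visit the
vertex `o` after each `K` steps. -/
lemma zetaFun_markovDyck_mul [Fintype V] [Finite E] {K : ℕ} {ht : V → ℕ} {o : V}
    (h0 : ∀ v, ht v = 0 ↔ v = o)
    (hK : ∀ v, ht v < K) (hstep : ∀ e, ht (G.tgt e) = (ht (G.src e) + 1) % K)
    {F : PowerSeries ℚ} (hF0 : constantCoeff F = 0)
    (hF : ∀ m, codeGenFun (G.climbWords o o (K * m)) = F ^ m) :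
    zetaFun G.markovDyck * ((∏ v, (1 - codeGenFun (G.code v))) * (1 - F) ^ 2) = 1 := by
  -- Trichotomy of the ψ-sum over a period; climbing and falling points each contribute the
  -- logarithm of 1/(1 - F).
  have key : (PowerSeries.mk fun n => if n = 0 then (0 : ℚ) else
      ((G.markovDyck ∩ Function.ptsOfPeriod leftShift n).ncard : ℚ) / n)
      = ∑ v, logInvOneSub (codeGenFun (G.code v)) + (logInvOneSub F + logInvOneSub F) := by
    ext n
    rw [coeff_mk, map_add, map_add, map_sum]
    rcases Nat.eq_zero_or_pos n with rfl | hn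
    · simp only [if_true, coeff_zero_eq_constantCoeff_apply, constantCoeff_logInvOneSub]
      simp
    rw [if_neg hn.ne', ← ncard_neutral_div hn, ← ncard_climb_div h0 hK hstep hF hn]
    conv_rhs => enter [2, 2]; rw [← ncard_fall_eq_climb]
    rw [← add_assoc]
    rw [← add_div, ← add_div, ← Nat.cast_add, ← Nat.cast_add,
      ← Set.ncard_union_eq ?_ ((finite_ptsOfPeriod hn).inter_of_right _)
        ((finite_ptsOfPeriod hn).inter_of_right _),
      ← Set.ncard_union_eq ?_ (((finite_ptsOfPeriod hn).inter_of_right _).union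
        ((finite_ptsOfPeriod hn).inter_of_right _)) ((finite_ptsOfPeriod hn).inter_of_right _)]
    · congr 3
      ext x
      simp only [Set.mem_inter_iff, Set.mem_union, Set.mem_ofPred_eq]
      rcases lt_trichotomy (psum (block x n)) 0 with h | h | h <;>
        simp [h, not_lt_of_gt, ne_of_lt, ne_of_gt]
    · rw [Set.disjoint_left]
      rintro x (⟨⟨-, h⟩, -⟩ | ⟨⟨-, h⟩, -⟩) ⟨⟨-, h'⟩, -⟩ <;> omega
    · rw [Set.disjoint_left]
      rintro x ⟨⟨-, h⟩, -⟩ ⟨⟨-, h'⟩, -⟩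
      omega
  have hc := fun f => constantCoeff_logInvOneSub f
  rw [zetaFun, key, expSubst_add, expSubst_add (hc F) (hc F), expSubst_sum _ _ fun v => hc _]
  · have h1 := expSubst_logInvOneSub_mul hF0
    have h2 : (∏ v, (exp ℚ).subst (logInvOneSub (codeGenFun (G.code v))))
        * ∏ v, (1 - codeGenFun (G.code v)) = 1 := by
      rw [← Finset.prod_mul_distrib]
      exact Finset.prod_eq_one fun v _ =>
        expSubst_logInvOneSub_mul (constantCoeff_codeGenFun_code v)
    set A := ∏ v, (exp ℚ).subst (logInvOneSub (codeGenFun (G.code v)))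
    set B := (exp ℚ).subst (logInvOneSub F)
    calc _ = (A * ∏ v, (1 - codeGenFun (G.code v))) * (B * (1 - F)) ^ 2 := by ring
      _ = 1 := by rw [h1, h2]; simp
  · rw [map_sum]; exact Finset.sum_eq_zero fun v _ => hc _
  · rw [map_add, hc, add_zero]

end DirGraph

lemma prod_range_mul_of_periodic {M : Type} [CommMonoid M] {f : ℕ → M} {p : ℕ}
    (hf : Function.Periodic f p) (m : ℕ) :
    ∏ i ∈ Finset.range (p * m), f i = (∏ i ∈ Finset.range p, f i) ^ m := by
  induction m with
  | zero => simp
  | succ m ih =>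
    rw [mul_add_one, Finset.prod_range_add, ih, pow_succ]
    congr 1
    refine Finset.prod_congr rfl fun i _ => ?_
    rw [add_comm, mul_comm]
    exact hf.nat_mul m i

/-! ### Rotationally homogeneous graphs. -/

namespace RHGraph

open PowerSeries DirGraph

variable {K : ℕ} {N : ℕ → ℕ}

lemma src_height (e : RHEdge K N) : (((rhGraph K N).src e).1 : ℕ) = e.1 := rfl

lemma tgt_height (e : RHEdge K N) :
    (((rhGraph K N).tgt e).1 : ℕ) = (((rhGraph K N).src e).1 + 1) % K := by
  rw [src_height]
  simp only [rhGraph]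
  split_ifs with h
  · exact (Nat.mod_eq_of_lt h).symm
  · rw [show (e.1 : ℕ) + 1 = K by omega, Nat.mod_self]

/-- The root. -/
def root (hK : 0 < K) : RHVertex K N := ⟨⟨0, hK⟩, fun i => i.elim0⟩

lemma height_eq_zero_iff (hK : 0 < K) (v : RHVertex K N) : (v.1 : ℕ) = 0 ↔ v = root hK := by
  constructor
  · obtain ⟨⟨h, hh⟩, x⟩ := v
    rintro (rfl : h = 0)
    simp only [root, Sigma.mk.injEq, heq_eq_eq, true_and]
    exact funext fun i => i.elim0
  · rintro rfl; rfl

lemma card_edges (v : RHVertex K N) :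
    (Finset.univ.filter fun e : RHEdge K N => (rhGraph K N).src e = v).card = N v.1 := by
  obtain ⟨h, x⟩ := v
  rw [← Finset.card_fin (N h)]
  symm
  refine Finset.card_bij (fun a _ => ⟨h, Fin.snoc (α := fun i : Fin (h + 1) => Fin (N i)) x a⟩)
    ?_ ?_ ?_
  · intro a _
    rw [Finset.mem_filter]
    simp [rhGraph]
  · intro a _ b _ hab
    simp only [Sigma.mk.injEq, heq_eq_eq, true_and] at hab
    have := congrFun hab (Fin.last h)
    simpa using this
  · rintro ⟨h', y⟩ he
    rw [Finset.mem_filter] at he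
    obtain ⟨-, he⟩ := he
    simp only [rhGraph, Sigma.mk.injEq] at he
    obtain ⟨rfl, he⟩ := he
    rw [heq_eq_eq] at he
    subst he
    refine ⟨y (Fin.last h'), Finset.mem_univ _, ?_⟩
    simp only [Sigma.mk.injEq, heq_eq_eq, true_and]
    exact Fin.snoc_init_self (α := fun i : Fin (h' + 1) => Fin (N i)) y

/-- The generating functions depend only on the height modulo the period of the data. -/
lemma codeGenFun_congr {p : ℕ} (hpK : p ∣ K) (hper : Function.Periodic N p) (hN : ∀ i, 0 < N i)
    {v w : RHVertex K N} (h : (v.1 : ℕ) ≡ w.1 [MOD p]) :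
    codeGenFun ((rhGraph K N).code v) = codeGenFun ((rhGraph K N).code w) := by
  set G := rhGraph K N with hG
  -- X-adic induction: the factor X² in the recursion for the code raises the precision with each
  -- pass through the edges.
  have key : ∀ n, ∀ v w : RHVertex K N, (v.1 : ℕ) ≡ w.1 [MOD p] →
      (X : PowerSeries ℚ) ^ n ∣ codeGenFun (G.code v) - codeGenFun (G.code w) := by
    intro n
    induction n with
    | zero => simp
    | succ n ih =>
      intro v w hvw
      have hD : ∀ v w : RHVertex K N, (v.1 : ℕ) ≡ w.1 [MOD p] →
          (X : PowerSeries ℚ) ^ n ∣ codeGenFun (G.dyckWords v) - codeGenFun (G.dyckWords w) := by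
        intro v w hvw
        have h1 := codeGenFun_dyckWords (G := G) v
        have h2 := codeGenFun_dyckWords (G := G) w
        have h3 : codeGenFun (G.dyckWords v) - codeGenFun (G.dyckWords w)
            = (codeGenFun (G.code v) - codeGenFun (G.code w)) *
              (codeGenFun (G.dyckWords v) * codeGenFun (G.dyckWords w)) := by
          linear_combination codeGenFun (G.dyckWords w) * h1 - codeGenFun (G.dyckWords v) * h2
        rw [h3]
        exact (ih v w hvw).mul_right _
      have hne : (Finset.univ.filter fun e : RHEdge K N => G.src e = w).Nonempty := by
        rw [← Finset.card_pos, card_edges]; exact hN _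
      obtain ⟨f, hf⟩ := hne
      have hf : G.src f = w := (Finset.mem_filter.1 hf).2
      have hNvw : N v.1 = N w.1 := by
        rw [← hper.map_mod_nat, show (v.1 : ℕ) % p = w.1 % p from hvw, hper.map_mod_nat]
      -- All edges, whether they leave `v` or `w`, are compared with one reference edge `f`, so no
      -- bijection between the edge sets is needed.
      have hg : ∀ u : RHVertex K N, (u.1 : ℕ) ≡ w.1 [MOD p] → (X : PowerSeries ℚ) ^ (n + 1) ∣
          codeGenFun (G.code u) - N u.1 • (X ^ 2 * codeGenFun (G.dyckWords (G.tgt f))) := by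
        intro u hu
        rw [codeGenFun_code, ← card_edges u, ← hG, ← Finset.sum_const, ← Finset.sum_sub_distrib]
        refine Finset.dvd_sum fun e he => ?_
        have he : G.src e = u := (Finset.mem_filter.1 he).2
        rw [← mul_sub]
        have h1 : (((G.tgt e).1 : ℕ)) ≡ (G.tgt f).1 [MOD p] := by
          rw [tgt_height, tgt_height]
          have h2 : ((G.src e).1 : ℕ) + 1 ≡ (G.src f).1 + 1 [MOD p] := by
            rw [he, hf]; exact hu.add_right 1
          exact ((Nat.mod_modEq _ K).of_dvd hpK).trans (h2.trans ((Nat.mod_modEq _ K).of_dvd hpK).symm)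
        calc (X : PowerSeries ℚ) ^ (n + 1) ∣ X ^ 2 * X ^ n := ⟨X, by ring⟩
          _ ∣ _ := mul_dvd_mul_left _ (hD _ _ h1)
      have h3 := dvd_sub (hg v hvw) (hg w rfl)
      rwa [hNvw, sub_sub_sub_cancel_right] at h3
  rw [← sub_eq_zero]
  ext n
  rw [map_zero]
  exact X_pow_dvd_iff.1 (key (n + 1) v w h) n n.lt_succ_self

/-- The zeta function of the Markov-Dyck shift of a rotationally homogeneous graph. -/
theorem zetaFun_mul {p : ℕ} (hK : 0 < K) (hpK : p ∣ K) (hper : Function.Periodic N p)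
    (hN : ∀ i, 0 < N i) :
    ∃ γ : ℕ → PowerSeries ℚ, Function.Periodic γ p ∧
      (∀ v : RHVertex K N, codeGenFun ((rhGraph K N).code v) = γ v.1) ∧
      (∀ k, constantCoeff (γ k) = 0) ∧
      (∀ k, γ k * (1 - γ (k + 1)) = (N k : PowerSeries ℚ) * X ^ 2) ∧
      zetaFun (rhGraph K N).markovDyck *
          (∏ k ∈ Finset.range K, (1 - γ k) ^ ∏ i ∈ Finset.range k, N i) *
          (∏ k ∈ Finset.range K, (1 - γ k)
            - ((∏ k ∈ Finset.range K, N k : ℕ) : PowerSeries ℚ) * X ^ K) ^ 2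
        = (∏ k ∈ Finset.range K, (1 - γ k)) ^ 2 := by
  set G := rhGraph K N with hG
  -- One representative vertex for each height; the indices run over all of ℕ so that periodicity
  -- replaces wrap-around at the top level.
  set r : ℕ → RHVertex K N := fun k => ⟨⟨k % K, Nat.mod_lt k hK⟩, fun i => ⟨0, hN i⟩⟩
  set γ : ℕ → PowerSeries ℚ := fun k => codeGenFun (G.code (r k))
  set δ : ℕ → PowerSeries ℚ := fun k => codeGenFun (G.dyckWords (r k))
  have hmod : ∀ k, k % K ≡ k [MOD p] := fun k => (Nat.mod_modEq k K).of_dvd hpK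
  have hγper : Function.Periodic γ p := fun k =>
    codeGenFun_congr hpK hper hN ((hmod _).trans (Nat.ModEq.trans (by simp [Nat.ModEq]) (hmod k).symm))
  have hg : ∀ v : RHVertex K N, codeGenFun (G.code v) = γ v.1 := fun v =>
    codeGenFun_congr hpK hper hN (hmod _).symm
  have hδ : ∀ k, δ k * (1 - γ k) = 1 := fun k => codeGenFun_dyckWords (r k)
  have hinv : ∀ {a b c : PowerSeries ℚ}, a * c = 1 → b * c = 1 → a = b := by
    intro a b c h1 h2
    linear_combination b * h1 - a * h2
  have hD : ∀ v : RHVertex K N, codeGenFun (G.dyckWords v) = δ v.1 := fun v =>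
    hinv (hg v ▸ codeGenFun_dyckWords (G := G) v) (hδ v.1)
  have hδper : Function.Periodic δ p := fun k => hinv (hγper k ▸ hδ (k + p)) (hδ k)
  have hKper : ∀ {R : Type} {f : ℕ → R}, Function.Periodic f p → Function.Periodic f K := by
    intro R f hf
    obtain ⟨c, rfl⟩ := hpK
    rw [mul_comm]
    exact hf.nat_mul c
  have hrec : ∀ k, γ k = (N k : PowerSeries ℚ) * X ^ 2 * δ (k + 1) := by
    intro k
    have hk : γ k = codeGenFun (G.code (r k)) := rfl
    rw [hk, codeGenFun_code, Finset.sum_congr rfl (g := fun _ => X ^ 2 * δ (k + 1))]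
    · rw [Finset.sum_const, hG, card_edges, nsmul_eq_mul, mul_assoc]
      congr 2
      exact (hKper hper).map_mod_nat k
    · intro e he
      have he : G.src e = r k := (Finset.mem_filter.1 he).2
      rw [hD, tgt_height, (hKper hδper).map_mod_nat]
      congr 1
      rw [← hG, he]
      have : Function.Periodic (fun j => δ (j + 1)) K := fun j => by
        dsimp only; rw [add_right_comm]; exact hKper hδper _
      exact this.map_mod_nat k
  -- The weight of an uncancelled edge leaving height k together with the Dyck word at its target.
  set a : ℕ → PowerSeries ℚ := fun k => (N k : PowerSeries ℚ) * (X * δ (k + 1))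
  have haper : Function.Periodic a K := fun k => by
    simp only [a]
    rw [hKper hper k, add_right_comm, hKper hδper]
  have hclimb : ∀ j (v : RHVertex K N), codeGenFun (G.climbWords (root hK) v j)
      = if K ∣ v.1 + j then ∏ i ∈ Finset.range j, a (v.1 + i) else 0 := by
    intro j
    induction j with
    | zero =>
      intro v
      rw [codeGenFun_climbWords_zero, add_zero, Finset.prod_range_zero]
      congr 1
      rw [← height_eq_zero_iff hK, eq_iff_iff]
      exact ⟨fun h => h ▸ dvd_zero K, fun h => Nat.eq_zero_of_dvd_of_lt h v.1.2⟩
    | succ j ih =>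
      intro v
      rw [codeGenFun_climbWords_succ, Finset.sum_congr rfl (g := fun _ => X * δ (v.1 + 1) *
        if K ∣ v.1 + 1 + j then ∏ i ∈ Finset.range j, a (v.1 + 1 + i) else 0)]
      · rw [Finset.sum_const, hG, card_edges, nsmul_eq_mul, ← mul_assoc, mul_ite, MulZeroClass.mul_zero,
          Finset.prod_range_succ', add_zero, add_right_comm, add_assoc]
        congr 1
        rw [mul_comm]
        congr 1
        exact Finset.prod_congr rfl fun i _ => by rw [add_assoc, add_comm 1 i]
      · intro e he
        have he : G.src e = v := (Finset.mem_filter.1 he).2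
        rw [ih, hD, tgt_height, (hKper hδper).map_mod_nat, ← hG, he]
        congr 1
        have h1 : K ∣ (v.1 + 1) % K + j ↔ K ∣ v.1 + 1 + j :=
          ((Nat.mod_modEq _ K).add_right j).dvd_iff dvd_rfl
        have h2 : ∀ i, a (((v.1 : ℕ) + 1) % K + i) = a (v.1 + 1 + i) := by
          intro i
          have : Function.Periodic (fun j => a (j + i)) K := fun j => by
            dsimp only; rw [add_right_comm]; exact haper _
          exact this.map_mod_nat _
        simp only [h1, h2]
  set F := ∏ i ∈ Finset.range K, a i with hF
  have hFpow : ∀ m, codeGenFun (G.climbWords (root hK) (root hK) (K * m)) = F ^ m := by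
    intro m
    rw [hclimb, if_pos (by simp [root]), hF, ← prod_range_mul_of_periodic haper]
    exact Finset.prod_congr rfl fun i _ => by simp [root]
  have hF0 : constantCoeff F = 0 := by
    rw [hF, map_prod]
    exact Finset.prod_eq_zero (Finset.mem_range.2 hK) (by simp [a])
  have hz := zetaFun_markovDyck_mul (G := G) (height_eq_zero_iff hK) (fun v => v.1.2) tgt_height
    hF0 hFpow
  have hγ0 : ∀ k, constantCoeff (γ k) = 0 := fun k => constantCoeff_codeGenFun_code _
  have hFP : F * ∏ k ∈ Finset.range K, (1 - γ k)
      = ((∏ k ∈ Finset.range K, N k : ℕ) : PowerSeries ℚ) * X ^ K := by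
    -- The Dyck words of a climb sit at targets, hence the cyclic shift of the index.
    have h1 : ∏ k ∈ Finset.range K, (1 - γ k) = ∏ k ∈ Finset.range K, (1 - γ (k + 1)) := by
      obtain ⟨k, rfl⟩ := Nat.exists_eq_add_of_le' hK
      rw [Finset.prod_range_succ', Finset.prod_range_succ]
      have := hKper hγper 0
      rw [zero_add] at this
      rw [this]
    rw [h1, hF, ← Finset.prod_mul_distrib]
    have h2 : ∀ k ∈ Finset.range K, a k * (1 - γ (k + 1)) = (N k : PowerSeries ℚ) * X := by
      intro k _
      linear_combination (N k : PowerSeries ℚ) * X * hδ (k + 1)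
    rw [Finset.prod_congr rfl h2, Finset.prod_mul_distrib]
    simp
  have hprod : ∏ v, (1 - codeGenFun (G.code v))
      = ∏ k ∈ Finset.range K, (1 - γ k) ^ ∏ i ∈ Finset.range k, N i := by
    rw [Fintype.prod_sigma, Finset.prod_range]
    refine Finset.prod_congr rfl fun k _ => ?_
    rw [Finset.prod_congr rfl (g := fun _ => 1 - γ k) fun x _ => by rw [hg], Finset.prod_const,
      Finset.card_univ, Fintype.card_pi, Finset.prod_range]
    simp
  refine ⟨γ, hγper, hg, hγ0, fun k => ?_, ?_⟩
  · rw [hrec k]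
    linear_combination (N k : PowerSeries ℚ) * X ^ 2 * hδ (k + 1)
  · rw [← hprod, ← hFP]
    -- Multiplying by the squared product turns (1 - F)² into the square of the product minus its
    -- multiple by F.
    linear_combination (∏ k ∈ Finset.range K, (1 - γ k)) ^ 2 * hz

end RHGraph

/-! ### Passage to Laurent series, where negative exponents make sense. -/

section LaurentForm

variable {K : ℕ}

lemma prod_zpow_mul {F : Type} [Field F] {ζ Q : F} {u : ℕ → F} {m : ℕ → ℕ} (hu : ∀ k, u k ≠ 0)
    (hQ : Q ≠ 0) (h : ζ * (∏ k ∈ Finset.range K, u k ^ m k) * Q ^ 2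
      = (∏ k ∈ Finset.range K, u k) ^ 2) :
    ζ = Q ^ (-2 : ℤ) * ∏ k ∈ Finset.range K, u k ^ (2 - (m k : ℤ)) := by
  have h1 : ∏ k ∈ Finset.range K, u k ^ (2 - (m k : ℤ))
      = (∏ k ∈ Finset.range K, u k) ^ 2 / ∏ k ∈ Finset.range K, u k ^ m k := by
    rw [← Finset.prod_pow, ← Finset.prod_div_distrib]
    refine Finset.prod_congr rfl fun k _ => ?_
    rw [zpow_sub₀ (hu k), zpow_natCast]; norm_cast
  have h2 : ∏ k ∈ Finset.range K, u k ^ m k ≠ 0 :=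
    Finset.prod_ne_zero_iff.2 fun k _ => pow_ne_zero _ (hu k)
  rw [h1, ← h, zpow_neg]
  norm_cast
  field_simp

/-- The powers of 2 on the right cancel: M + (2n - M) - 2n = 0. They are there because 1 + s = 2u
for the square root s. -/
lemma two_zpow_mul {F : Type} [Field F] {ζ Q u : F} {M n : ℕ} (h2 : (2 : F) ≠ 0) (hu : u ≠ 0)
    (hQ : Q ≠ 0) (h : ζ * u ^ M * Q ^ 2 = (u ^ n) ^ 2) :
    ζ = 2 ^ (M : ℤ) * (2 * u) ^ (2 * (n : ℤ) - M) * (2 ^ n * Q) ^ (-2 : ℤ) := by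
  have hζ : ζ = (u ^ n) ^ 2 / (u ^ M * Q ^ 2) := by
    rw [eq_div_iff (mul_ne_zero (pow_ne_zero _ hu) (pow_ne_zero _ hQ)), ← mul_assoc]; exact h
  rw [hζ, zpow_sub₀ (mul_ne_zero h2 hu), zpow_neg, show 2 * (n : ℤ) = ((2 * n : ℕ) : ℤ) by simp,
    zpow_natCast, zpow_natCast, zpow_natCast, show (2 : ℤ) = ((2 : ℕ) : ℤ) from rfl, zpow_natCast]
  field_simp
  rw [mul_pow 2 u M, mul_comm 2 n, pow_mul (2 * u), mul_pow 2 u n]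
  ring

open PowerSeries

lemma coe_ne_zero_of_constantCoeff {f : PowerSeries ℚ} (hf : constantCoeff f = 1) :
    (f : LaurentSeries ℚ) ≠ 0 := by
  intro h
  have h1 : f = 0 := HahnSeries.ofPowerSeries_injective (h.trans (map_zero _).symm)
  simp [h1] at hf

lemma constantCoeff_prod_one_sub_sub {γ : ℕ → PowerSeries ℚ} (hγ : ∀ k, constantCoeff (γ k) = 0)
    (hK : 0 < K) (c : PowerSeries ℚ) :
    constantCoeff (∏ k ∈ Finset.range K, (1 - γ k) - c * X ^ K) = 1 := by
  rw [map_sub, map_prod, map_mul, map_pow, constantCoeff_X, zero_pow hK.ne', MulZeroClass.mul_zero,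
    sub_zero]
  exact Finset.prod_eq_one fun k _ => by simp [hγ]

end LaurentForm

/-! ### The formulas for periodic and for constant data. -/

lemma periodic_periodicData {H : ℕ} (N : Fin (H + 1) → ℕ) :
    Function.Periodic (periodicData N) (H + 1) := fun k => by
  simp only [periodicData]
  congr 1
  ext
  simp [Fin.ofNat]

lemma zetaFun_rhGraph_periodicData (H L : ℕ) (N : Fin (H + 1) → ℕ) (hL : 1 ≤ L)
    (hN : ∀ i, 1 ≤ N i) :
    ∃ g : Fin (H + 1) → PowerSeries ℚ,
      (∀ v : RHVertex (L * (H + 1)) (periodicData N),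
        codeGenFun ((rhGraph (L * (H + 1)) (periodicData N)).code v)
          = g (Fin.ofNat (H + 1) (v.1 : ℕ))) ∧
      (zetaFun (rhGraph (L * (H + 1)) (periodicData N)).markovDyck : LaurentSeries ℚ)
        = (((∏ h, (1 - g h)) ^ L
              - PowerSeries.C (((∏ h, N h : ℕ) : ℚ) ^ L) * PowerSeries.X ^ (L * (H + 1)) :
                PowerSeries ℚ) : LaurentSeries ℚ) ^ (-2 : ℤ)
          * ∏ k ∈ Finset.range (L * (H + 1)),
              ((1 - g (Fin.ofNat (H + 1) k) : PowerSeries ℚ) : LaurentSeries ℚ)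
                ^ (2 - ((∏ i ∈ Finset.range k, periodicData N i : ℕ) : ℤ)) := by
  have hK : 0 < L * (H + 1) := by positivity
  have hper := periodic_periodicData N
  obtain ⟨γ, hγp, hγ, hγ0, -, hz⟩ := RHGraph.zetaFun_mul hK (dvd_mul_left (H + 1) L) hper
    (fun i => hN _)
  have hmod : ∀ k, γ (Fin.ofNat (H + 1) k : Fin (H + 1)) = γ k := fun k => hγp.map_mod_nat k
  have hPγ : ∏ k ∈ Finset.range (L * (H + 1)), (1 - γ k)
      = (∏ h : Fin (H + 1), (1 - γ h)) ^ L := by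
    rw [mul_comm, prod_range_mul_of_periodic (f := fun k => 1 - γ k), Finset.prod_range]
    intro k; simp only [hγp k]
  have hPN : ∏ k ∈ Finset.range (L * (H + 1)), periodicData N k = (∏ h, N h) ^ L := by
    rw [mul_comm, prod_range_mul_of_periodic hper, Finset.prod_range]
    congr 1
    refine Finset.prod_congr rfl fun h _ => ?_
    simp [periodicData]
  refine ⟨fun h => γ h, fun v => (hγ v).trans (hmod _).symm, ?_⟩
  simp only [hmod]
  rw [← hPγ]
  have hC : PowerSeries.C (((∏ h, N h : ℕ) : ℚ) ^ L)
      = ((∏ k ∈ Finset.range (L * (H + 1)), periodicData N k : ℕ) : PowerSeries ℚ) := by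
    rw [hPN, ← Nat.cast_pow, map_natCast]
  rw [hC]
  refine prod_zpow_mul (fun k => coe_ne_zero_of_constantCoeff (by simp [hγ0]))
    (coe_ne_zero_of_constantCoeff (constantCoeff_prod_one_sub_sub hγ0 hK _)) ?_
  have := congrArg (HahnSeries.ofPowerSeries ℤ ℚ) hz
  simpa only [map_mul, map_pow, map_prod] using this

open PowerSeries in
lemma zetaFun_rhGraph_const (H N : ℕ) (hN : 2 ≤ N) :
    ∃ s : PowerSeries ℚ,
      PowerSeries.constantCoeff s = 1 ∧
      s ^ 2 = 1 - PowerSeries.C (4 * (N : ℚ)) * PowerSeries.X ^ 2 ∧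
      (zetaFun (rhGraph (H + 1) (fun _ => N)).markovDyck : LaurentSeries ℚ)
        = 2 ^ (((N : ℤ) ^ (H + 1) - 1) / ((N : ℤ) - 1))
          * ((1 + s : PowerSeries ℚ) : LaurentSeries ℚ)
              ^ (2 * (H : ℤ) + 2 - ((N : ℤ) ^ (H + 1) - 1) / ((N : ℤ) - 1))
          * (((1 + s) ^ (H + 1)
              - (PowerSeries.C (2 * (N : ℚ)) * PowerSeries.X) ^ (H + 1) :
                PowerSeries ℚ) : LaurentSeries ℚ) ^ (-2 : ℤ) := by
  have hK : 0 < H + 1 := H.succ_pos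
  obtain ⟨γ, hγp, -, hγ0, hrec, hz⟩ := RHGraph.zetaFun_mul (N := fun _ => N) hK (one_dvd (H + 1))
    (fun _ => rfl) (fun i => by omega)
  have hγc : ∀ k, γ k = γ 0 := fun k => by simpa using hγp.nat_mul k 0
  -- The number of vertices, as a geometric sum.
  set M := ∑ k ∈ Finset.range (H + 1), N ^ k
  have hM : ((N : ℤ) ^ (H + 1) - 1) / ((N : ℤ) - 1) = M := by
    refine Int.ediv_eq_of_eq_mul_left (by omega) ?_
    rw [← geom_sum_mul]; push_cast [M]; rfl
  have hQ0 := constantCoeff_prod_one_sub_sub hγ0 hK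
    ((∏ k ∈ Finset.range (H + 1), N : ℕ) : PowerSeries ℚ)
  simp only [hγc, Finset.prod_const, Finset.card_range, Finset.prod_pow_eq_pow_sum] at hz hrec hQ0
  have hrec := hrec 0
  rw [hM]
  set u := 1 - γ 0 with hu
  have hC : ∀ a : ℕ, PowerSeries.C ((a : ℚ)) = (a : PowerSeries ℚ) := fun a => map_natCast _ a
  have h4 : PowerSeries.C (4 * (N : ℚ)) = 4 * (N : PowerSeries ℚ) := by
    have := hC (4 * N); push_cast at this; exact this
  have h2 : PowerSeries.C (2 * (N : ℚ)) = 2 * (N : PowerSeries ℚ) := by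
    have := hC (2 * N); push_cast at this; exact this
  -- Constant data have period 1, so all γ agree and γ(1 - γ) = NX²; then (1 - 2γ)² = 1 - 4γ(1 - γ).
  refine ⟨1 - 2 * γ 0, by simp [hγ0], ?_, ?_⟩
  · rw [h4]
    linear_combination (-4) * hrec + 4 * γ 0 * hu
  have h1s : (1 + (1 - 2 * γ 0) : PowerSeries ℚ) = 2 * u := by
    linear_combination (-2) * hu
  have hden : (1 + (1 - 2 * γ 0)) ^ (H + 1) - (PowerSeries.C (2 * (N : ℚ)) * X) ^ (H + 1)
      = 2 ^ (H + 1) * (u ^ (H + 1) - ((N ^ (H + 1) : ℕ) : PowerSeries ℚ) * X ^ (H + 1)) := by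
    rw [h1s, h2, Nat.cast_pow, mul_pow, mul_pow, mul_pow, mul_sub, mul_assoc]
  rw [hden, h1s]
  set Q := u ^ (H + 1) - ((N ^ (H + 1) : ℕ) : PowerSeries ℚ) * X ^ (H + 1)
  have hφ := congrArg (HahnSeries.ofPowerSeries ℤ ℚ) hz
  simp only [map_mul, map_pow] at hφ ⊢
  have hu' : (u : LaurentSeries ℚ) ≠ 0 := coe_ne_zero_of_constantCoeff (by simp [hu, hγ0])
  have hQ' : (Q : LaurentSeries ℚ) ≠ 0 := coe_ne_zero_of_constantCoeff hQ0
  have h2' : HahnSeries.ofPowerSeries ℤ ℚ 2 = 2 := map_ofNat _ 2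
  have h2n : (2 : LaurentSeries ℚ) ≠ 0 := by
    intro h
    have h1 : (2 : PowerSeries ℚ) = 0 :=
      HahnSeries.ofPowerSeries_injective ((h2'.trans h).trans (map_zero _).symm)
    have h3 := congrArg constantCoeff h1
    rw [map_ofNat, map_zero] at h3
    norm_num at h3
  rw [h2', show 2 * (H : ℤ) + 2 = 2 * ((H + 1 : ℕ) : ℤ) by push_cast; ring]
  exact two_zpow_mul h2n hu' hQ' hφ

theorem proposition4p3 :
    (∀ (H L : ℕ) (N : Fin (H + 1) → ℕ), 1 ≤ L → (∀ i, 1 ≤ N i) → 2 ≤ N (Fin.last H) →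
      ∃ g : Fin (H + 1) → PowerSeries ℚ,
        (∀ v : RHVertex (L * (H + 1)) (periodicData N),
          codeGenFun ((rhGraph (L * (H + 1)) (periodicData N)).code v)
            = g (Fin.ofNat (H + 1) (v.1 : ℕ))) ∧
        (zetaFun (rhGraph (L * (H + 1)) (periodicData N)).markovDyck : LaurentSeries ℚ)
          = (((∏ h, (1 - g h)) ^ L
                - PowerSeries.C (((∏ h, N h : ℕ) : ℚ) ^ L) * PowerSeries.X ^ (L * (H + 1)) :
                  PowerSeries ℚ) : LaurentSeries ℚ) ^ (-2 : ℤ)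
            * ∏ k ∈ Finset.range (L * (H + 1)),
                ((1 - g (Fin.ofNat (H + 1) k) : PowerSeries ℚ) : LaurentSeries ℚ)
                  ^ (2 - ((∏ i ∈ Finset.range k, periodicData N i : ℕ) : ℤ))) ∧
    (∀ H N : ℕ, 2 ≤ N →
      ∃ s : PowerSeries ℚ,
        PowerSeries.constantCoeff s = 1 ∧
        s ^ 2 = 1 - PowerSeries.C (4 * (N : ℚ)) * PowerSeries.X ^ 2 ∧
        (zetaFun (rhGraph (H + 1) (fun _ => N)).markovDyck : LaurentSeries ℚ)
          = 2 ^ (((N : ℤ) ^ (H + 1) - 1) / ((N : ℤ) - 1))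
            * ((1 + s : PowerSeries ℚ) : LaurentSeries ℚ)
                ^ (2 * (H : ℤ) + 2 - ((N : ℤ) ^ (H + 1) - 1) / ((N : ℤ) - 1))
            * (((1 + s) ^ (H + 1)
                - (PowerSeries.C (2 * (N : ℚ)) * PowerSeries.X) ^ (H + 1) :
                  PowerSeries ℚ) : LaurentSeries ℚ) ^ (-2 : ℤ)) := by
  exact ⟨fun H L N hL hN _ => zetaFun_rhGraph_periodicData H L N hL hN,
    zetaFun_rhGraph_const⟩
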